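/- Consider scheduling on related machines: there are $n\ge 1$ machines, controlled by selfish agents, and $m\ge 0$ jobs with publicly known positive rational loads $w_1,\dots,w_m$. The type of agent $i$ is her processing time $t_i>0$ per unit of load, a rational number from an arbitrary domain $D_i\subseteq\mathbb{Q}_{>0}$. In a schedule $x$ (an assignment of the jobs to the machines) in which machine $i$ receives total load $x_i$, the cost of an agent $i$ of type $t_i$ is $t_i(x)=t_i\,x_i$; for a profile $b$ of declared types the makespan is $\max_i b_i\,x_i$. A mechanism $\mathcal M$ returns, for a profile $b$ of declared types (the profile according to which the agents act), a schedule $f(b)$ and payments $p_i(b)$ to the agents. With monitoring, the cost of agent $i$ with true type $t_i$ is $$c_i(t_i,\mathcal M(b))=\max\{t_i(f(b)),\,b_i(f(b))\}-p_i(b).$$ An extensive-form mechanism is obviously strategy-proof (OSP) with monitoring if, for every agent $i$, every vertex $u$ of its tree at which $i$ is asked to act, and all profiles $(t_i,b_{-i})$ and $(b_i,b'_{-i})$ that are compatible with $u$ and diverge at $u$, one has $c_i(t_i,\mathcal M(t_i,b_{-i}))\le c_i(t_i,\mathcal M(b_i,b'_{-i}))$. It satisfies voluntary participation if $c_i(t_i,\mathcal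 M(t_i,b_{-i}))\le 0$ for all $i$, $t_i$ and $b_{-i}$. Then the following hold. (1) There is a single algorithm that computes, from the job loads and the declared types, a schedule and payments in time $2^{\mathrm{poly}(s)}$, where $s$ is the bit length of the input, such that the schedule always has minimum makespan with respect to the declared types and such that, for all job loads and all domains $D_i$, the direct-revelation mechanism given by this algorithm is OSP with monitoring and satisfies voluntary participation. (2) There is a single algorithm that computes, from a rational $\varepsilon>0$, the job loads and the declared types, a schedule and payments, such that for every fixed $\varepsilon$ the running time is polynomial in the bit length of the job loads and declared types, the makespan of the schedule is always at most $1+\varepsilon$ times the minimum makespan with respect to the declared types, and, for all job loads and all domains $D_i$, the direct-revelation mechanism given by this algorithm is OSP with monitoring and satisfies voluntary participation. That is, there is an OSP mechanism with monitoring that is a PTAS, and it satisfies voluntary participation. -/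

import Mathlib

/-! ## Extensive-form mechanisms, obvious strategyproofness, monitoring

`ι` is the type of agents, `Θ i` the domain of agent `i`, a profile is a `b : ∀ i, Θ i`. -/

/-- Trees of extensive-form mechanisms. A leaf carries an outcome. An internal vertex `u` carries
the set `S` of agents it interacts with, and one outgoing edge for each `a : A`. The label of the
edge `a` is the set of the profiles `b` compatible with `u` such that `act b = a`: labels of
different edges are then disjoint and their union is the set of profiles compatible with `u`.
Branching may be infinite, every branch is finite. -/
inductive GameTree {ι : Type} (Θ : ι → Type) (O : Type) : Type 1
  | leaf (outcome : O) : GameTree Θ O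
  | node (S : Set ι) (A : Type) (act : (∀ i, Θ i) → A) (child : A → GameTree Θ O) : GameTree Θ O

namespace GameTree

/-- The outcome at the leaf that is reached when the agents act according to `b`. -/
def run {ι : Type} {Θ : ι → Type} {O : Type} : GameTree Θ O → (∀ i, Θ i) → O
  | leaf o, _ => o
  | node _ _ act child, b => (child (act b)).run b

/-- `P` is the set of profiles compatible with the root of the tree. At every vertex, the action
taken depends only on the types of the agents in `S`. -/
def WellFormed {ι : Type} {Θ : ι → Type} {O : Type} :
    GameTree Θ O → Set (∀ i, Θ i) → Prop
  | leaf _, _ => True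
  | node S _ act child, P =>
      (∀ b ∈ P, ∀ b' ∈ P, (∀ i ∈ S, b i = b' i) → act b = act b') ∧
      ∀ a, (child a).WellFormed {b | b ∈ P ∧ act b = a}

/-- `c i t b` is the cost of agent `i` with true type `t` when the agents act according to `b`,
and `P` is the set of profiles compatible with the root of the tree. At every vertex `u` and for
every agent `i ∈ S(u)`: if `b` and `b'` are compatible with `u` and diverge at `u`, then agent `i`
with true type `b i` does not prefer the outcome for `b'` to the one for `b`. -/
def ObviouslyStrategyProof {ι : Type} {Θ : ι → Type} {O : Type}
    (c : ∀ i, Θ i → (∀ j, Θ j) → ℝ) : GameTree Θ O → Set (∀ i, Θ i) → Prop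
  | leaf _, _ => True
  | node S _ act child, P =>
      (∀ i ∈ S, ∀ b ∈ P, ∀ b' ∈ P, act b ≠ act b' → c i (b i) b ≤ c i (b i) b') ∧
      ∀ a, (child a).ObviouslyStrategyProof c {b | b ∈ P ∧ act b = a}

end GameTree

/-- An extensive-form mechanism whose outcomes are pairs of a solution in `X` and payments from
the mechanism to the agents. -/
structure Mechanism {ι : Type} (Θ : ι → Type) (X : Type) where
  tree : GameTree Θ (X × (ι → ℝ))
  wellFormed : tree.WellFormed Set.univ

namespace Mechanism

/-- The cost of agent `i` in a mechanism with monitoring, when her true type is `t` and the agents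
act according to `b`; here `cost i s x` is the cost of solution `x` for agent `i` of type `s`. -/
noncomputable def monitoredCost {ι : Type} {Θ : ι → Type} {X : Type} (M : Mechanism Θ X)
    (cost : ∀ i, Θ i → X → ℝ) (i : ι) (t : Θ i) (b : ∀ j, Θ j) : ℝ :=
  max (cost i t (M.tree.run b).1) (cost i (b i) (M.tree.run b).1) - (M.tree.run b).2 i

/-- The mechanism is obviously strategy-proof with monitoring. -/
def IsOSPWithMonitoring {ι : Type} {Θ : ι → Type} {X : Type} (M : Mechanism Θ X)
    (cost : ∀ i, Θ i → X → ℝ) : Prop :=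
  M.tree.ObviouslyStrategyProof (M.monitoredCost cost) Set.univ

/-- A truthful agent never has a positive cost. -/
def VoluntaryParticipation {ι : Type} {Θ : ι → Type} {X : Type} (M : Mechanism Θ X)
    (cost : ∀ i, Θ i → X → ℝ) : Prop :=
  ∀ (i : ι) (b : ∀ j, Θ j), M.monitoredCost cost i (b i) b ≤ 0

/-- The direct-revelation mechanism: all agents are asked for their types, simultaneously and
once; then the outcome `(f b, p b)` for the declared profile `b` is returned. -/
def directRevelation {ι : Type} {Θ : ι → Type} {X : Type} (f : (∀ i, Θ i) → X)
    (p : (∀ i, Θ i) → ι → ℝ) : Mechanism Θ X where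
  tree := .node Set.univ (∀ i, Θ i) (fun b => b) fun b => .leaf (f b, p b)
  wellFormed := ⟨fun _ _ _ _ h => funext fun i => h i (Set.mem_univ i), fun _ => trivial⟩

end Mechanism

/-! ## Scheduling on related machines -/

/-- Positive rational numbers: the loads of jobs and the processing times per unit of load. -/
abbrev PosRat : Type := {q : ℚ // 0 < q}

/-- The load of machine `i` in a schedule: the total load of the jobs assigned to it. -/
def machineLoad {n m : ℕ} (w : Fin m → PosRat) (σ : Fin m → Fin n) (i : Fin n) : ℚ :=
  ∑ j : Fin m, if σ j = i then (w j : ℚ) else 0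

/-- The makespan of schedule `σ` when machine `i` needs time `b i` per unit of load. -/
def makespan {n m : ℕ} [NeZero n] (w : Fin m → PosRat) (b : Fin n → PosRat)
    (σ : Fin m → Fin n) : ℚ :=
  Finset.univ.sup' Finset.univ_nonempty fun i : Fin n => (b i : ℚ) * machineLoad w σ i

/-- The cost of a schedule for machine `i` when her type is `t`. Here machine `i` has an arbitrary
domain `D i` of types. -/
noncomputable def scheduleCost {n m : ℕ} (w : Fin m → PosRat) (D : Fin n → Set PosRat)
    (i : Fin n) (t : D i) (σ : Fin m → Fin n) : ℝ :=
  (((t : PosRat) : ℚ) * machineLoad w σ i : ℚ)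

/-- A social choice function and payments for all scheduling problems: from the number `n ≥ 1` of
machines, the loads `w` of the `m` jobs (which are public) and the declared types `b`, it
determines a schedule and the payments to the machines. -/
structure SchedulingMechanism where
  schedule : ∀ {n m : ℕ} [NeZero n], (Fin m → PosRat) → (Fin n → PosRat) → (Fin m → Fin n)
  payment : ∀ {n m : ℕ} [NeZero n], (Fin m → PosRat) → (Fin n → PosRat) → (Fin n → ℚ)

namespace SchedulingMechanism

/-- The direct-revelation mechanism for job loads `w` and domains `D`. -/
def onDomain (A : SchedulingMechanism) {n m : ℕ} [NeZero n] (w : Fin m → PosRat)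
    (D : Fin n → Set PosRat) : Mechanism (fun i => D i) (Fin m → Fin n) :=
  Mechanism.directRevelation (fun b => A.schedule w fun i => (b i : PosRat))
    fun b i => (A.payment w (fun k => (b k : PosRat)) i : ℝ)

def IsOSPWithMonitoring (A : SchedulingMechanism) : Prop :=
  ∀ (n m : ℕ) [NeZero n] (w : Fin m → PosRat) (D : Fin n → Set PosRat),
    (A.onDomain w D).IsOSPWithMonitoring (scheduleCost w D)

def VoluntaryParticipation (A : SchedulingMechanism) : Prop :=
  ∀ (n m : ℕ) [NeZero n] (w : Fin m → PosRat) (D : Fin n → Set PosRat),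
    (A.onDomain w D).VoluntaryParticipation (scheduleCost w D)

/-- The schedule has minimum makespan with respect to the declared types. -/
def IsOptimal (A : SchedulingMechanism) : Prop :=
  ∀ (n m : ℕ) [NeZero n] (w : Fin m → PosRat) (b : Fin n → PosRat) (σ : Fin m → Fin n),
    makespan w b (A.schedule w b) ≤ makespan w b σ

/-- The makespan is at most `α` times the optimum. -/
def IsApproximate (A : SchedulingMechanism) (α : ℚ) : Prop :=
  ∀ (n m : ℕ) [NeZero n] (w : Fin m → PosRat) (b : Fin n → PosRat) (σ : Fin m → Fin n),
    makespan w b (A.schedule w b) ≤ α * makespan w b σ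

end SchedulingMechanism

/-! ## Programs and their running time

A small `while` language over pairs and natural numbers with logarithmic cost: numbers are written
in binary, and every step of a program is charged the size (the bit length) of the data to which
it is applied. As for random access machines with logarithmic cost, the running time is polynomially
related to that of Turing machines. -/

inductive Val
  | num (k : ℕ) : Val
  | pair (x y : Val) : Val

namespace Val

/-- The number of bits needed to write a value, up to a constant factor. -/
def size : Val → ℕ
  | num k => Nat.size k + 1
  | pair x y => size x + size y + 1

/-- Lists, with `num 0` as the empty list. -/
def list : List Val → Val
  | [] => num 0
  | x :: l => pair x (list l)

/-- A positive rational, as its numerator and denominator in lowest terms. -/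
def ofPosRat (q : PosRat) : Val := pair (num (q : ℚ).num.toNat) (num (q : ℚ).den)

/-- The input for a scheduling problem: the list of job loads and the list of declared types. -/
def ofInstance {n m : ℕ} (w : Fin m → PosRat) (b : Fin n → PosRat) : Val :=
  pair (list (List.ofFn fun j => ofPosRat (w j))) (list (List.ofFn fun i => ofPosRat (b i)))

/-- The value is a fraction, not necessarily in lowest terms, that represents `q`. -/
def IsFraction (v : Val) (q : ℚ) : Prop :=
  ∃ a d : ℕ, d ≠ 0 ∧ v = pair (num a) (num d) ∧ q = (a : ℚ) / (d : ℚ)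

/-- The value represents a schedule and payments: it consists of the list of the machines to which
the jobs are assigned and the list of the payments. -/
def IsOutcome {n m : ℕ} (v : Val) (σ : Fin m → Fin n) (p : Fin n → ℚ) : Prop :=
  ∃ u : Fin n → Val, (∀ i, (u i).IsFraction (p i)) ∧
    v = pair (list (List.ofFn fun j => num (σ j : ℕ))) (list (List.ofFn u))

end Val

/-- Programs; each of them maps values to values. -/
inductive Prog
  /-- return the input -/
  | skip : Prog
  /-- return the constant `v` -/
  | const (v : Val) : Prog
  /-- the first component of a pair -/
  | fst : Prog
  /-- the second component of a pair -/
  | snd : Prog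
  /-- `1` on a number, `0` on a pair -/
  | isNum : Prog
  /-- arithmetic on a pair of numbers: sum, truncated difference, product, integer quotient -/
  | add : Prog
  | sub : Prog
  | mul : Prog
  | div : Prog
  /-- run `p` and `q` on the input and return the pair of the results -/
  | both (p q : Prog) : Prog
  /-- run `p` on the input, then `q` on the result -/
  | seq (p q : Prog) : Prog
  /-- run `p` if `c` does not return `0` on the input, and `q` otherwise -/
  | cond (c p q : Prog) : Prog
  /-- while `c` does not return `0` on the current value, replace this value by the result of `p` -/
  | loop (c p : Prog) : Prog

namespace Prog

/-- The value of an elementary operation; `0` where the input does not have the right shape. -/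
def arith (op : ℕ → ℕ → ℕ) : Val → Val
  | .pair (.num a) (.num b) => .num (op a b)
  | _ => .num 0

def first : Val → Val
  | .pair x _ => x
  | .num _ => .num 0

def second : Val → Val
  | .pair _ y => y
  | .num _ => .num 0

def numTest : Val → Val
  | .num _ => .num 1
  | .pair _ _ => .num 0

/-- `Eval p x y k`: the program `p` halts on input `x`, with result `y` and running time `k`. -/
inductive Eval : Prog → Val → Val → ℕ → Prop
  | skip (x : Val) : Eval skip x x x.size
  | const (v x : Val) : Eval (const v) x v x.size
  | fst (x : Val) : Eval fst x (first x) x.size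
  | snd (x : Val) : Eval snd x (second x) x.size
  | isNum (x : Val) : Eval isNum x (numTest x) x.size
  | add (x : Val) : Eval add x (arith (fun a b => a + b) x) x.size
  | sub (x : Val) : Eval sub x (arith (fun a b => a - b) x) x.size
  | mul (x : Val) : Eval mul x (arith (fun a b => a * b) x) x.size
  | div (x : Val) : Eval div x (arith (fun a b => a / b) x) x.size
  | both {p q : Prog} {x y z : Val} {k l : ℕ} :
      Eval p x y k → Eval q x z l → Eval (both p q) x (.pair y z) (x.size + k + l)
  | seq {p q : Prog} {x y z : Val} {k l : ℕ} :
      Eval p x y k → Eval q y z l → Eval (seq p q) x z (x.size + k + l)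
  | condTrue {c p q : Prog} {x v y : Val} {k l : ℕ} :
      Eval c x v k → v ≠ .num 0 → Eval p x y l → Eval (cond c p q) x y (x.size + k + l)
  | condFalse {c p q : Prog} {x y : Val} {k l : ℕ} :
      Eval c x (.num 0) k → Eval q x y l → Eval (cond c p q) x y (x.size + k + l)
  | loopDone {c p : Prog} {x : Val} {k : ℕ} :
      Eval c x (.num 0) k → Eval (loop c p) x x (x.size + k)
  | loopStep {c p : Prog} {x v y z : Val} {k l r : ℕ} :
      Eval c x v k → v ≠ .num 0 → Eval p x y l → Eval (loop c p) y z r →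
      Eval (loop c p) x z (x.size + k + l + r)

end Prog

namespace SchedulingMechanism

/-- One program computes the schedule and the payments from the job loads and the declared types,
in time `2 ^ poly(s)` on inputs of size `s`. -/
def RunsInExponentialTime (A : SchedulingMechanism) : Prop :=
  ∃ (P : Prog) (T : Polynomial ℕ), ∀ (n m : ℕ) [NeZero n] (w : Fin m → PosRat)
    (b : Fin n → PosRat), ∃ (v : Val) (k : ℕ),
      P.Eval (Val.ofInstance w b) v k ∧ v.IsOutcome (A.schedule w b) (A.payment w b) ∧
      k ≤ 2 ^ T.eval (Val.ofInstance w b).size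

/-- A polynomial-time approximation scheme: one program takes the accuracy `ε > 0` as well as the
job loads and declared types, and computes a schedule within a factor `1 + ε` of the optimum and
the payments; for every fixed `ε`, its running time is polynomial in the size of the job loads and
declared types. -/
def IsPTAS (A : PosRat → SchedulingMechanism) : Prop :=
  (∀ ε : PosRat, (A ε).IsApproximate (1 + (ε : ℚ))) ∧
  ∃ P : Prog, ∀ ε : PosRat, ∃ T : Polynomial ℕ, ∀ (n m : ℕ) [NeZero n] (w : Fin m → PosRat)
    (b : Fin n → PosRat), ∃ (v : Val) (k : ℕ),
      P.Eval (.pair (Val.ofPosRat ε) (Val.ofInstance w b)) v k ∧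
      v.IsOutcome ((A ε).schedule w b) ((A ε).payment w b) ∧
      k ≤ T.eval (Val.ofInstance w b).size

end SchedulingMechanism

/-! ## Polynomially bounded functions -/

/-! Incentives cost nothing here. If every machine is paid exactly the cost it declares, a truthful
machine has monitored cost `max c c - c = 0`, and under any other behaviour the monitored cost is
`max c' c - c ≥ 0`. Hence, whatever the schedules are, the mechanism is OSP with monitoring and
satisfies voluntary participation (`isOSPWithMonitoring_payingCosts`). What remains is to compute
good schedules within the time bounds.

One dynamic program serves both parts. Loads and types are made integral, and loads are rounded up
to few significant bits, at the price of a factor `1 + 1/q`. For a makespan `T` the machines are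
treated from slow to fast. On a machine with time `b`, a job of load `r` is small if `q * b * r ≤ T`
and large if it is not small but fits. Large jobs are tried in all ways, where partial schedules
with equal key (numbers of unassigned jobs of each large load, load of the machine) are merged in
favour of the least unassigned volume. Small jobs are then poured in until the machine exceeds `T`,
which overshoots by at most `T / q`.

Soundness is `isSound_search`. Completeness is `exists_mem_search`: given a schedule of rounded
makespan at most `T`, some kept partial schedule always has as many unassigned jobs of each load not
small for the current machine as that schedule, and no more unassigned volume. A job that is not
small for a faster machine is not small for a slower one either, so this survives the passage to the
next machine. Binary search over `T` then loses only the factor `(1 + 1/q) ^ 2`.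

The number of states is at most `(m + 1) ^ (2 * L)`, where `L` bounds the number of distinct large
loads on a machine (`card_largeLoads_le`). With `L` a function of `q` alone and `q = 3 * ε.den + 1`
this gives the PTAS. With `L ≤ m` and `q` so large that the error is below one unit of the integral
makespan, it gives the exact algorithm in time `2 ^ poly`. -/

theorem Polynomial.eval_mono_nat (T : Polynomial ℕ) {x y : ℕ} (h : x ≤ y) :
    T.eval x ≤ T.eval y := by
  rw [Polynomial.eval_eq_sum_range, Polynomial.eval_eq_sum_range]
  gcongr

/-- `F` is bounded by a polynomial in `μ`. -/
def PolyBdd {α : Type} (μ F : α → ℕ) : Prop := ∃ T : Polynomial ℕ, ∀ a, F a ≤ T.eval (μ a)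

namespace PolyBdd

variable {α β : Type} {μ F G : α → ℕ}

theorem self : PolyBdd μ μ := ⟨.X, fun a => by simp⟩

theorem const (c : ℕ) : PolyBdd μ fun _ => c := ⟨.C c, fun a => by simp⟩

theorem mono (hG : PolyBdd μ G) (h : ∀ a, F a ≤ G a) : PolyBdd μ F :=
  let ⟨T, hT⟩ := hG
  ⟨T, fun a => (h a).trans (hT a)⟩

theorem add (hF : PolyBdd μ F) (hG : PolyBdd μ G) : PolyBdd μ fun a => F a + G a :=
  let ⟨S, hS⟩ := hF
  let ⟨T, hT⟩ := hG
  ⟨S + T, fun a => by simpa using add_le_add (hS a) (hT a)⟩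

theorem mul (hF : PolyBdd μ F) (hG : PolyBdd μ G) : PolyBdd μ fun a => F a * G a :=
  let ⟨S, hS⟩ := hF
  let ⟨T, hT⟩ := hG
  ⟨S * T, fun a => by simpa using Nat.mul_le_mul (hS a) (hT a)⟩

theorem eval (T : Polynomial ℕ) (hF : PolyBdd μ F) : PolyBdd μ fun a => T.eval (F a) :=
  let ⟨S, hS⟩ := hF
  ⟨T.comp S, fun a => by simpa using T.eval_mono_nat (hS a)⟩

end PolyBdd

/-! ## Computable functions between encoded types -/

namespace Val

theorem size_pos (v : Val) : 0 < v.size := by cases v <;> simp [size]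

end Val

/-- Types whose elements are represented by values. -/
class ToVal (α : Type) where
  toVal : α → Val


open ToVal (toVal)

instance : ToVal ℕ := ⟨.num⟩
instance : ToVal Bool := ⟨fun b => .num b.toNat⟩
instance {α β : Type} [ToVal α] [ToVal β] : ToVal (α × β) := ⟨fun p => .pair (toVal p.1) (toVal p.2)⟩
instance {α : Type} [ToVal α] : ToVal (List α) := ⟨fun l => .list (l.map toVal)⟩

/-- The number of bits needed to write an element of an encoded type. -/
def bits {α : Type} [ToVal α] (a : α) : ℕ := (toVal a).size

section bits

variable {α β : Type} [ToVal α] [ToVal β]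

theorem bits_nat (k : ℕ) : bits k = Nat.size k + 1 := rfl

theorem bits_bool (b : Bool) : bits b ≤ 2 := by cases b <;> simp [bits, toVal, Val.size]

theorem bits_prod (p : α × β) : bits p = bits p.1 + bits p.2 + 1 := rfl

theorem bits_nil : bits ([] : List α) = 1 := by simp [bits, toVal, Val.list, Val.size]

theorem bits_cons (x : α) (l : List α) : bits (x :: l) = bits x + bits l + 1 := rfl

theorem bits_list (l : List α) : bits l = (l.map fun x => bits x + 1).sum + 1 := by
  induction l with
  | nil => rfl
  | cons x l ih => rw [bits_cons, ih, List.map_cons, List.sum_cons]; ring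

theorem bits_append (l l' : List α) : bits (l ++ l') + 1 = bits l + bits l' := by
  simp only [bits_list, List.map_append, List.sum_append]; ring

theorem bits_le_of_mem {x : α} {l : List α} (h : x ∈ l) : bits x ≤ bits l := by
  induction l with
  | nil => simp at h
  | cons y l ih =>
    rw [bits_cons]
    rcases List.mem_cons.1 h with rfl | h
    · omega
    · have := ih h; omega

theorem length_lt_bits (l : List α) : l.length < bits l := by
  induction l with
  | nil => simp [bits_nil]
  | cons y l ih => rw [bits_cons, List.length_cons]; omega

theorem bits_le_of_sublist {l l' : List α} (h : l.Sublist l') : bits l ≤ bits l' := by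
  induction h with
  | slnil => rfl
  | cons x _ ih => rw [bits_cons]; omega
  | cons_cons x _ ih => rw [bits_cons, bits_cons]; omega

theorem bits_list_le {l : List α} {B : ℕ} (h : ∀ x ∈ l, bits x ≤ B) :
    bits l ≤ l.length * (B + 1) + 1 := by
  rw [bits_list]
  have := List.sum_le_card_nsmul (l.map fun x => bits x + 1) (B + 1) (by simpa using h)
  simpa using this

theorem bits_add_le (a b : ℕ) : bits (a + b) ≤ bits a + bits b := by
  simp only [bits_nat]
  suffices h : Nat.size (a + b) ≤ Nat.size a + Nat.size b + 1 by omega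
  rw [Nat.size_le]
  have h1 : 1 ≤ 2 ^ Nat.size a := Nat.one_le_two_pow
  have h2 : 1 ≤ 2 ^ Nat.size b := Nat.one_le_two_pow
  have := Nat.lt_size_self a
  have := Nat.lt_size_self b
  rw [pow_succ, pow_add]
  nlinarith

theorem bits_mul_le (a b : ℕ) : bits (a * b) ≤ bits a + bits b := by
  simp only [bits_nat]
  suffices h : Nat.size (a * b) ≤ Nat.size a + Nat.size b by omega
  rw [Nat.size_le, pow_add]
  have := Nat.lt_size_self a
  have := Nat.lt_size_self b
  exact Nat.mul_lt_mul'' ‹_› ‹_›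

theorem bits_mono {a b : ℕ} (h : a ≤ b) : bits a ≤ bits b := by
  simp only [bits_nat]
  have := Nat.size_le_size h
  omega

end bits

/-! ### Growth of data and cost of `while` loops. -/

namespace Prog

theorem Eval.size_le {P : Prog} {x y : Val} {k : ℕ} (h : P.Eval x y k) : x.size ≤ k := by
  cases h <;> omega

/-- The total size of the constants in a program. -/
def constSize : Prog → ℕ
  | .isNum => 1
  | .const v => v.size
  | .both p q => p.constSize + q.constSize + 1
  | .seq p q => p.constSize + q.constSize
  | .cond _ p q => p.constSize + q.constSize
  | .loop _ p => p.constSize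
  | _ => 0

theorem size_arith_le {op : ℕ → ℕ → ℕ} (h : ∀ a b, Nat.size (op a b) ≤ Nat.size a + Nat.size b + 2)
    (x : Val) : (arith op x).size ≤ x.size := by
  unfold arith
  split
  · rename_i a b
    have := h a b
    simp only [Val.size]
    omega
  · have := x.size_pos
    simp only [Val.size, Nat.size_zero]; omega

/-- Apart from constants, pairing and the answers of `isNum`, no operation returns more than the
size of its input, which has been paid for. A time bound therefore also bounds the size of the
output, so compositions need no separate size estimates. -/
theorem Eval.size_result_le {P : Prog} {x y : Val} {k : ℕ} (h : P.Eval x y k) :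
    y.size ≤ k + P.constSize := by
  induction h with
  | skip x => simp
  | const v x => simp [constSize]
  | fst x => cases x <;> simp only [first, Val.size, constSize, Nat.size_zero] <;> omega
  | snd x => cases x <;> simp only [second, Val.size, constSize, Nat.size_zero] <;> omega
  -- The input `0` has size 1 but the answer `1` has size 2; hence the 1 in `constSize`.
  | isNum x =>
    have := x.size_pos
    cases x <;> simp only [numTest, Val.size, constSize, Nat.size_zero, Nat.size_one] at * <;> omega
  | add x =>
    refine (size_arith_le (fun a b => ?_) x).trans (by simp)
    have := bits_add_le a b
    simp only [bits_nat] at this; omega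
  | sub x =>
    refine (size_arith_le (fun a b => ?_) x).trans (by simp)
    have := Nat.size_le_size (Nat.sub_le a b); omega
  | mul x =>
    refine (size_arith_le (fun a b => ?_) x).trans (by simp)
    have := bits_mul_le a b
    simp only [bits_nat] at this; omega
  | div x =>
    refine (size_arith_le (fun a b => ?_) x).trans (by simp)
    have := Nat.size_le_size (Nat.div_le_self a b); omega
  | both h1 h2 ih1 ih2 =>
    rename_i x _ _ _ _
    simp only [Val.size, constSize]; omega
  | seq h1 h2 ih1 ih2 => simp only [constSize]; omega
  | condTrue h1 hv h2 ih1 ih2 => simp only [constSize]; omega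
  | condFalse h1 h2 ih1 ih2 => simp only [constSize]; omega
  | loopDone h1 ih1 => omega
  | loopStep h1 hv h2 h3 ih1 ih2 ih3 => simp only [constSize] at *; omega

/-- A round is charged for the test, the body and the size of the state. The last is at most the
time of the test, whence `3 * B`; the extra round is the final test. -/
theorem Eval.iterate {c p : Prog} {s : ℕ → Val} {B : ℕ} (N : ℕ)
    (hc : ∀ t < N, ∃ v k, c.Eval (s t) v k ∧ v ≠ .num 0 ∧ k ≤ B)
    (hp : ∀ t < N, ∃ k, p.Eval (s t) (s (t + 1)) k ∧ k ≤ B)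
    (hN : ∃ k, c.Eval (s N) (.num 0) k ∧ k ≤ B) :
    ∃ k, (loop c p).Eval (s 0) (s N) k ∧ k ≤ (N + 1) * (3 * B) := by
  induction N generalizing s with
  | zero =>
    obtain ⟨k, hk, hkB⟩ := hN
    exact ⟨_, .loopDone hk, by have := hk.size_le; omega⟩
  | succ N ih =>
    obtain ⟨v, k, hk, hv, hkB⟩ := hc 0 (by omega)
    obtain ⟨l, hl, hlB⟩ := hp 0 (by omega)
    obtain ⟨r, hr, hrB⟩ := ih (s := fun t => s (t + 1)) (fun t ht => hc (t + 1) (by omega))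
      (fun t ht => hp (t + 1) (by omega)) hN
    refine ⟨_, .loopStep hk hv hl hr, ?_⟩
    have := hk.size_le
    linarith [add_mul (N + 1) 1 (3 * B)]

end Prog

/-- `f` is computed by a program whose running time is polynomial in `μ`. -/
def Comp {α β : Type} [ToVal α] [ToVal β] (μ : α → ℕ) (f : α → β) : Prop :=
  ∃ (P : Prog) (T : Polynomial ℕ), ∀ a, ∃ k, P.Eval (toVal a) (toVal (f a)) k ∧ k ≤ T.eval (μ a)

/-- `f` is computable in polynomial time. -/
abbrev PT {α β : Type} [ToVal α] [ToVal β] (f : α → β) : Prop := Comp bits f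

/-! ### Closure of `Comp` under composition, pairing, branching and loops. -/

namespace Comp

variable {α β γ σ : Type} [ToVal α] [ToVal β] [ToVal γ] [ToVal σ] {μ : α → ℕ} {ν : β → ℕ}

theorem bits_input {f : α → β} (h : Comp μ f) : PolyBdd μ bits :=
  let ⟨_, T, hP⟩ := h
  ⟨T, fun a => let ⟨_, hk, hkT⟩ := hP a; hk.size_le.trans hkT⟩

theorem bits_output {f : α → β} (h : Comp μ f) : PolyBdd μ fun a => bits (f a) :=
  let ⟨P, T, hP⟩ := h
  ⟨T + .C P.constSize, fun a => by
    obtain ⟨k, hk, hkT⟩ := hP a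
    have := hk.size_result_le
    simp only [Polynomial.eval_add, Polynomial.eval_C, bits]
    omega⟩

theorem comp {g : β → γ} {f : α → β} (hg : Comp ν g) (hf : Comp μ f)
    (h : PolyBdd μ fun a => ν (f a)) : Comp μ fun a => g (f a) := by
  obtain ⟨P, S, hP⟩ := hf
  obtain ⟨Q, T, hQ⟩ := hg
  obtain ⟨U, hU⟩ := h
  refine ⟨.seq P Q, S + S + T.comp U, fun a => ?_⟩
  obtain ⟨k, hk, hkS⟩ := hP a
  obtain ⟨l, hl, hlT⟩ := hQ (f a)
  refine ⟨_, .seq hk hl, ?_⟩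
  have := hk.size_le
  have := T.eval_mono_nat (hU a)
  simp only [Polynomial.eval_add, Polynomial.eval_comp] at *
  omega

theorem congr {f g : α → β} (hf : Comp μ f) (h : ∀ a, f a = g a) : Comp μ g := funext h ▸ hf

theorem mono {ν : α → ℕ} {f : α → β} (hf : Comp ν f) (h : PolyBdd μ ν) : Comp μ f := by
  obtain ⟨P, S, hP⟩ := hf
  obtain ⟨U, hU⟩ := h
  refine ⟨P, S.comp U, fun a => ?_⟩
  obtain ⟨k, hk, hkS⟩ := hP a
  refine ⟨k, hk, hkS.trans ?_⟩
  rw [Polynomial.eval_comp]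
  exact S.eval_mono_nat (hU a)

theorem prod {f : α → β} {g : α → γ} (hf : Comp μ f) (hg : Comp μ g) :
    Comp μ fun a => (f a, g a) := by
  obtain ⟨P, S, hP⟩ := hf
  obtain ⟨Q, T, hQ⟩ := hg
  refine ⟨.both P Q, S + S + T, fun a => ?_⟩
  obtain ⟨k, hk, hkS⟩ := hP a
  obtain ⟨l, hl, hlT⟩ := hQ a
  refine ⟨_, .both hk hl, ?_⟩
  have := hk.size_le
  simp only [Polynomial.eval_add]
  omega

theorem ite {c : α → Prop} [∀ a, Decidable (c a)] {f g : α → β} (hc : Comp μ fun a => decide (c a))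
    (hf : Comp μ f) (hg : Comp μ g) : Comp μ fun a => if c a then f a else g a := by
  obtain ⟨R, U, hR⟩ := hc
  obtain ⟨P, S, hP⟩ := hf
  obtain ⟨Q, T, hQ⟩ := hg
  refine ⟨.cond R P Q, U + U + S + T, fun a => ?_⟩
  obtain ⟨r, hr, hrU⟩ := hR a
  obtain ⟨k, hk, hkS⟩ := hP a
  obtain ⟨l, hl, hlT⟩ := hQ a
  have := hr.size_le
  simp only [Polynomial.eval_add]
  by_cases h : c a
  · simp only [h, if_true, decide_true] at hr ⊢
    exact ⟨_, .condTrue hr (by simp [toVal]) hk, by omega⟩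
  · simp only [h, if_false, decide_false] at hr ⊢
    exact ⟨_, .condFalse hr hl, by omega⟩

/-- A `while` loop, with the states `s a 0, …, s a (N a)`. -/
theorem iterate {s : α → ℕ → β} {N : α → ℕ} {c : β → Bool} {p : β → β} (hc : PT c) (hp : PT p)
    (hs : ∀ a, ∀ t < N a, s a (t + 1) = p (s a t)) (ht : ∀ a, ∀ t < N a, c (s a t) = true)
    (hN : ∀ a, c (s a (N a)) = false) (h0 : Comp μ fun a => s a 0) (hNb : PolyBdd μ N)
    {B : α → ℕ} (hB : PolyBdd μ B) (hsB : ∀ a, ∀ t ≤ N a, bits (s a t) ≤ B a) :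
    Comp μ fun a => s a (N a) := by
  obtain ⟨R, U, hR⟩ := hc
  obtain ⟨P, S, hP⟩ := hp
  obtain ⟨Q, T, hQ⟩ := h0
  have hU := PolyBdd.eval (U + S) hB
  obtain ⟨V, hV⟩ := (hNb.add (.const 1)).mul (PolyBdd.mul (.const 3) hU)
  refine ⟨.seq Q (.loop R P), T + T + V, fun a => ?_⟩
  obtain ⟨k, hk, hkT⟩ := hQ a
  have hle : ∀ t ≤ N a, U.eval (bits (s a t)) ≤ U.eval (B a) ∧ S.eval (bits (s a t)) ≤ S.eval (B a) :=
    fun t ht => ⟨U.eval_mono_nat (hsB a t ht), S.eval_mono_nat (hsB a t ht)⟩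
  obtain ⟨l, hl, hlB⟩ := Prog.Eval.iterate (c := R) (p := P) (s := fun t => toVal (s a t))
    (B := (U + S).eval (B a)) (N a)
    (fun t h => by
      obtain ⟨r, hr, hrU⟩ := hR (s a t)
      have := hle t h.le
      exact ⟨_, r, hr, by simp [ht a t h, toVal], by rw [Polynomial.eval_add]; omega⟩)
    (fun t h => by
      obtain ⟨r, hr, hrS⟩ := hP (s a t)
      have := hle t h.le
      exact ⟨r, by simpa only [hs a t h] using hr, by rw [Polynomial.eval_add]; omega⟩)
    (by
      obtain ⟨r, hr, hrU⟩ := hR (s a (N a))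
      have := hle _ le_rfl
      exact ⟨r, by simpa [hN a, toVal] using hr, by rw [Polynomial.eval_add]; omega⟩)
  refine ⟨_, .seq hk hl, ?_⟩
  have := hk.size_le
  have := hV a
  simp only [Polynomial.eval_add] at *
  omega

end Comp

namespace PT

variable {α β γ σ : Type} [ToVal α] [ToVal β] [ToVal γ] [ToVal σ]

theorem comp {μ : α → ℕ} {g : β → γ} {f : α → β} (hg : PT g) (hf : Comp μ f) :
    Comp μ fun a => g (f a) := Comp.comp hg hf hf.bits_output

theorem comp₂ {μ : α → ℕ} {g : β → γ → σ} {f : α → β} {h : α → γ}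
    (hg : PT fun p : β × γ => g p.1 p.2) (hf : Comp μ f) (hh : Comp μ h) :
    Comp μ fun a => g (f a) (h a) := comp hg (hf.prod hh)

theorem id : PT fun a : α => a := ⟨.skip, .X, fun a => ⟨_, .skip _, by simp [bits]⟩⟩

theorem const (b : β) : PT fun _ : α => b :=
  ⟨.const (toVal b), .X, fun a => ⟨_, .const _ _, by simp [bits]⟩⟩

theorem fst : PT fun p : α × β => p.1 :=
  ⟨.fst, .X, fun _ => ⟨_, .fst _, by simp [bits]⟩⟩

theorem snd : PT fun p : α × β => p.2 :=
  ⟨.snd, .X, fun _ => ⟨_, .snd _, by simp [bits]⟩⟩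

theorem add : PT fun p : ℕ × ℕ => p.1 + p.2 :=
  ⟨.add, .X, fun _ => ⟨_, .add _, by simp [bits]⟩⟩

theorem sub : PT fun p : ℕ × ℕ => p.1 - p.2 :=
  ⟨.sub, .X, fun _ => ⟨_, .sub _, by simp [bits]⟩⟩

theorem mul : PT fun p : ℕ × ℕ => p.1 * p.2 :=
  ⟨.mul, .X, fun _ => ⟨_, .mul _, by simp [bits]⟩⟩

theorem div : PT fun p : ℕ × ℕ => p.1 / p.2 :=
  ⟨.div, .X, fun _ => ⟨_, .div _, by simp [bits]⟩⟩

/-- A nonempty list is encoded as the pair of its head and tail, so that consing is the identity on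
codes. For the empty list, encoded as `0`, the default value `0` of the projections is right for
`tail` and `headD` as well. -/
theorem cons : PT fun p : α × List α => p.1 :: p.2 :=
  ⟨.skip, .X, fun _ => ⟨_, .skip _, by simp [bits]⟩⟩

theorem tail : PT fun l : List α => l.tail :=
  ⟨.snd, .X, fun l => ⟨(toVal l).size, by cases l <;> exact .snd _, by simp [bits]⟩⟩

theorem headD : PT fun l : List ℕ => l.headD 0 :=
  ⟨.fst, .X, fun l => ⟨(toVal l).size, by cases l <;> exact .fst _, by simp [bits]⟩⟩

theorem isEmpty : PT fun l : List α => l.isEmpty :=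
  ⟨.isNum, .X, fun l => ⟨(toVal l).size, by cases l <;> exact .isNum _, by simp [bits]⟩⟩

theorem eq_zero : PT fun k : ℕ => decide (k = 0) :=
  ⟨.cond .skip (.const (.num 0)) (.const (.num 1)), 3 * .X, fun k => by
    by_cases h : k = 0
    · subst h
      exact ⟨_, .condFalse (.skip _) (.const _ _), by simp [bits]; omega⟩
    · simp only [h, decide_false]
      exact ⟨_, .condTrue (.skip _) (by simpa [toVal] using h) (.const _ _), by simp [bits]; omega⟩⟩

theorem le : PT fun p : ℕ × ℕ => decide (p.1 ≤ p.2) :=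
  (eq_zero.comp sub).congr fun p => by simp [Nat.sub_eq_zero_iff_le]

end PT

namespace Comp

variable {α β γ σ : Type} [ToVal α] [ToVal β] [ToVal γ] [ToVal σ] {μ : α → ℕ}

theorem fst {f : α → β × γ} (hf : Comp μ f) : Comp μ fun a => (f a).1 := PT.fst.comp hf

theorem snd {f : α → β × γ} (hf : Comp μ f) : Comp μ fun a => (f a).2 := PT.snd.comp hf

theorem add {f g : α → ℕ} (hf : Comp μ f) (hg : Comp μ g) : Comp μ fun a => f a + g a :=
  PT.comp₂ PT.add hf hg

theorem sub {f g : α → ℕ} (hf : Comp μ f) (hg : Comp μ g) : Comp μ fun a => f a - g a :=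
  PT.comp₂ PT.sub hf hg

theorem mul {f g : α → ℕ} (hf : Comp μ f) (hg : Comp μ g) : Comp μ fun a => f a * g a :=
  PT.comp₂ PT.mul hf hg

theorem div {f g : α → ℕ} (hf : Comp μ f) (hg : Comp μ g) : Comp μ fun a => f a / g a :=
  PT.comp₂ PT.div hf hg

theorem cons {f : α → β} {g : α → List β} (hf : Comp μ f) (hg : Comp μ g) :
    Comp μ fun a => f a :: g a := PT.comp₂ PT.cons hf hg

theorem const (h : PolyBdd μ bits) (b : β) : Comp μ fun _ => b := mono (PT.const b) h

theorem le {f g : α → ℕ} (hf : Comp μ f) (hg : Comp μ g) : Comp μ fun a => decide (f a ≤ g a) :=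
  PT.comp₂ (g := fun a b => decide (a ≤ b)) PT.le hf hg

theorem not {c : α → Prop} [∀ a, Decidable (c a)] (hc : Comp μ fun a => decide (c a)) :
    Comp μ fun a => decide (¬ c a) :=
  (hc.ite (const hc.bits_input false) (const hc.bits_input true)).congr fun a => by
    by_cases h : c a <;> simp [h]

theorem and {c d : α → Prop} [∀ a, Decidable (c a)] [∀ a, Decidable (d a)]
    (hc : Comp μ fun a => decide (c a)) (hd : Comp μ fun a => decide (d a)) :
    Comp μ fun a => decide (c a ∧ d a) :=
  (hc.ite hd (const hc.bits_input false)).congr fun a => by by_cases h : c a <;> simp [h]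

theorem lt {f g : α → ℕ} (hf : Comp μ f) (hg : Comp μ g) : Comp μ fun a => decide (f a < g a) :=
  (hg.le hf).not.congr fun a => by simp

theorem eq {f g : α → ℕ} (hf : Comp μ f) (hg : Comp μ g) : Comp μ fun a => decide (f a = g a) :=
  ((hf.le hg).and (hg.le hf)).congr fun a => by simp [le_antisymm_iff]

theorem isTrue {c : α → Bool} (hc : Comp μ c) : Comp μ fun a => decide (c a = true) :=
  hc.congr fun a => by simp

theorem eq_nil {f : α → List β} [∀ a, Decidable (f a = [])] (hf : Comp μ f) :
    Comp μ fun a => decide (f a = []) :=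
  (PT.isEmpty.comp hf).congr fun a => by rw [Bool.eq_iff_iff, decide_eq_true_iff, List.isEmpty_iff]

/-- A loop over a list; the body runs in time polynomial in `ν`. -/
theorem foldl {l : α → List β} {init : α → σ} {step : α → σ → β → σ} {ν : α × σ × β → ℕ}
    (hstep : Comp ν fun p => step p.1 p.2.1 p.2.2) (hl : Comp μ l) (hi : Comp μ init)
    {B : α → ℕ} (hB : PolyBdd μ B)
    (hν : ∀ a l₁ x l₂, l a = l₁ ++ x :: l₂ → ν (a, l₁.foldl (step a) (init a), x) ≤ B a) :
    Comp μ fun a => (l a).foldl (step a) (init a) := by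
  -- The loop state is the input, the remaining list and the accumulator. The body reads the
  -- remaining list as a pair of head and tail, which has the same code when the list is nonempty.
  let body : α × (β × List β) × σ → α × List β × σ :=
    fun x => (x.1, x.2.1.2, step x.1 x.2.2 x.2.1.1)
  let ν' : α × (β × List β) × σ → ℕ := fun x => bits x + ν (x.1, x.2.2, x.2.1.1)
  have hbits : PolyBdd ν' bits := PolyBdd.self.mono fun x => Nat.le_add_right _ _
  have hid : Comp ν' fun x => x := mono PT.id hbits
  have hbody : Comp ν' body :=
    hid.fst.prod (hid.snd.fst.snd.prod (hstep.comp (hid.fst.prod (hid.snd.snd.prod hid.snd.fst.fst))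
      (PolyBdd.self.mono fun x => Nat.le_add_left _ _)))
  obtain ⟨U, hU⟩ := hstep.bits_input
  obtain ⟨V, hV⟩ := hstep.bits_output
  let s : α → ℕ → σ := fun a t => ((l a).take t).foldl (step a) (init a)
  let C : α → ℕ := fun a => bits a + bits (l a) + bits (init a) + (U + V).eval (B a) + 2
  have hC : PolyBdd μ C :=
    (((hi.bits_input.add hl.bits_output).add hi.bits_output).add (.eval _ hB)).add (.const 2)
  have hlt : ∀ a, ∀ t < (l a).length, ∃ x, (l a).drop t = x :: (l a).drop (t + 1) ∧
      s a (t + 1) = step a (s a t) x ∧ ν (a, s a t, x) ≤ B a := by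
    intro a t ht
    refine ⟨(l a)[t], List.drop_eq_getElem_cons ht, ?_, ?_⟩
    · simp only [s, ← List.take_concat_get' (l a) t ht, List.foldl_append, List.foldl_cons, List.foldl_nil]
    · refine hν a _ _ ((l a).drop (t + 1)) ?_
      rw [← List.drop_eq_getElem_cons ht, List.take_append_drop]
  have hdrop : ∀ a t, bits ((l a).drop t) ≤ bits (l a) :=
    fun a t => bits_le_of_sublist (List.drop_sublist _ _)
  have hsC : ∀ a, ∀ t ≤ (l a).length, bits a + bits ((l a).drop t) + bits (s a t) + 2 ≤ C a := by
    intro a t ht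
    have := hdrop a t
    suffices h : bits (s a t) ≤ bits (init a) + (U + V).eval (B a) by simp only [C]; omega
    -- After the first round the accumulator is an output of the body, so its size is bounded
    -- through the cost of the previous round.
    cases t with
    | zero => exact Nat.le_add_right _ _
    | succ t =>
      obtain ⟨x, -, h, hx⟩ := hlt a t ht
      have h1 := (hV (a, s a t, x)).trans (V.eval_mono_nat hx)
      rw [h, Polynomial.eval_add]
      simp only at h1
      omega
  obtain ⟨Q, T, hQ⟩ := (PT.id.mono hi.bits_input).prod (hl.prod hi)
  obtain ⟨P, S, hP⟩ := hbody
  obtain ⟨W, hW⟩ := (hl.bits_output.add (.const 1)).mul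
    (PolyBdd.mul (.const 3) (((hC.add hC).add hC).add (.eval S (hC.add hB))))
  -- The loop test returns the remaining list itself: its code is `0` exactly when it is empty.
  refine ⟨.seq Q (.seq (.loop (.seq .snd .fst) P) (.seq .snd .snd)),
    T + T + W + W + hC.choose + hC.choose + hC.choose, fun a => ?_⟩
  have hCa := hC.choose_spec a
  obtain ⟨k, hk, hkT⟩ := hQ a
  have hsize : ∀ t ≤ (l a).length, (toVal (a, (l a).drop t, s a t)).size ≤ C a := by
    intro t ht
    have := hsC a t ht
    change bits _ ≤ _
    simp only [bits_prod]
    omega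
  have htest : ∀ t ≤ (l a).length, ∃ k, Prog.Eval (.seq .snd .fst) (toVal (a, (l a).drop t, s a t))
      (toVal ((l a).drop t)) k ∧ k ≤ C a + C a + C a := fun t ht => by
    refine ⟨_, .seq (.snd _) (.fst _), ?_⟩
    have h1 := hsize t ht
    have h2 : (Prog.second (toVal (a, (l a).drop t, s a t))).size ≤
      (toVal (a, (l a).drop t, s a t)).size := by
      simp only [toVal, Prog.second, Val.size]; omega
    omega
  obtain ⟨r, hr, hrB⟩ := Prog.Eval.iterate (c := .seq .snd .fst) (p := P)
    (s := fun t => toVal (a, (l a).drop t, s a t)) (B := C a + C a + C a + S.eval (C a + B a))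
    (l a).length
    (fun t ht => by
      obtain ⟨k, hk, hkC⟩ := htest t ht.le
      obtain ⟨x, hx, -, -⟩ := hlt a t ht
      exact ⟨_, k, hk, by rw [hx]; exact Val.noConfusion, by omega⟩)
    (fun t ht => by
      obtain ⟨x, hx, hxs, hxB⟩ := hlt a t ht
      obtain ⟨k, hk, hkS⟩ := hP (a, (x, (l a).drop (t + 1)), s a t)
      refine ⟨k, ?_, hkS.trans ((S.eval_mono_nat (y := C a + B a) ?_).trans (Nat.le_add_left _ _))⟩
      · simp only [hx, hxs]; exact hk
      · have := hsC a t ht.le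
        rw [hx, bits_cons] at this
        simp only [ν', bits_prod]
        omega)
    (by
      obtain ⟨k, hk, hkC⟩ := htest _ le_rfl
      refine ⟨k, ?_, by omega⟩
      rw [List.drop_length] at hk ⊢
      exact hk)
  have hlen := length_lt_bits (l a)
  have hfin : s a (l a).length = (l a).foldl (step a) (init a) := by simp [s]
  refine ⟨_, .seq hk (.seq (y := toVal (a, (l a).drop (l a).length, s a (l a).length)) hr
    (.seq (.snd _) (by beta_reduce; rw [← hfin]; exact .snd _))), ?_⟩
  have h1 := hk.size_le
  have h2 := hr.size_le
  have h3 := hsize _ le_rfl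
  have h4 : (Prog.second (toVal (a, (l a).drop (l a).length, s a (l a).length))).size ≤
      (toVal (a, (l a).drop (l a).length, s a (l a).length)).size := by
    simp only [toVal, Prog.second, Val.size]; omega
  have h5 := (hrB.trans (Nat.mul_le_mul_right _ (by omega))).trans (hW a)
  change (toVal (a, l a, init a)).size ≤ r at h2
  simp only [Polynomial.eval_add] at *
  omega

/-- A loop over a list whose body adds a bounded number of bits to the state. -/
theorem foldl_of_bits_add {l : α → List β} {init : α → σ} {step : α → σ → β → σ}
    (hstep : PT fun p : α × σ × β => step p.1 p.2.1 p.2.2) (hl : Comp μ l) (hi : Comp μ init)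
    {T : Polynomial ℕ}
    (hT : ∀ a s x, bits (step a s x) ≤ bits s + T.eval (bits a + bits x)) :
    Comp μ fun a => (l a).foldl (step a) (init a) := by
  have key : ∀ a (l : List β) s D, (∀ x ∈ l, T.eval (bits a + bits x) ≤ D) →
      bits (l.foldl (step a) s) ≤ bits s + l.length * D := by
    intro a l
    induction l with
    | nil => simp
    | cons x l ih =>
      intro s D hD
      rw [List.foldl_cons, List.length_cons]
      have h1 := ih (step a s x) D fun y hy => hD y (List.mem_cons_of_mem _ hy)
      have h2 := hT a s x
      have h3 := hD x List.mem_cons_self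
      linarith [add_mul l.length 1 D]
  refine foldl (ν := bits) hstep hl hi
    (B := fun a => bits a + (bits (init a) + bits (l a) * T.eval (bits a + bits (l a))) + bits (l a) + 2)
    ?_ ?_
  · exact ((hi.bits_input.add (hi.bits_output.add (hl.bits_output.mul
      (.eval T (hi.bits_input.add hl.bits_output))))).add hl.bits_output).add (.const 2)
  · intro a l₁ x l₂ h
    have hx : bits x ≤ bits (l a) := bits_le_of_mem (by simp [h])
    have hl₁ : l₁.length ≤ bits (l a) := by
      have := length_lt_bits (l a)
      rw [h] at this ⊢
      simp only [List.length_append] at this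
      omega
    have := key a l₁ (init a) (T.eval (bits a + bits (l a))) fun y hy =>
      T.eval_mono_nat (by have : bits y ≤ bits (l a) := bits_le_of_mem (by simp [h, hy])
                          omega)
    have := Nat.mul_le_mul_right (T.eval (bits a + bits (l a))) hl₁
    simp only [bits_prod]
    omega

end Comp

/-! ### A polynomial-time list library. -/

namespace Comp

variable {α β γ σ : Type} [ToVal α] [ToVal β] [ToVal γ] [ToVal σ] {μ : α → ℕ}

protected theorem id : Comp bits fun a : α => a := PT.id

theorem reverse {l : α → List β} (hl : Comp μ l) : Comp μ fun a => (l a).reverse :=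
  (foldl_of_bits_add (step := fun (_ : α) (s : List β) x => x :: s) (T := .X + 1)
    (cons Comp.id.snd.snd Comp.id.snd.fst) hl (const hl.bits_input [])
    fun a s x => by simp [bits_cons]; omega).congr fun a => by simp

theorem append {l l' : α → List β} (hl : Comp μ l) (hl' : Comp μ l') : Comp μ fun a => l a ++ l' a :=
  (foldl_of_bits_add (step := fun (_ : α) (s : List β) x => x :: s) (T := .X + 1)
    (cons Comp.id.snd.snd Comp.id.snd.fst) hl.reverse hl'
    fun a s x => by simp [bits_cons]; omega).congr fun a => by simp

theorem map {l : α → List β} {f : α → β → γ} (hl : Comp μ l)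
    (hf : PT fun p : α × β => f p.1 p.2) :
    Comp μ fun a => (l a).map (f a) := by
  obtain ⟨T, hT⟩ := hf.bits_output
  refine (foldl_of_bits_add (step := fun a (s : List γ) x => f a x :: s)
    (T := T.comp (.X + 1) + 1)
    (cons (PT.comp₂ hf Comp.id.fst Comp.id.snd.snd) Comp.id.snd.fst) hl.reverse
    (const hl.bits_input []) fun a s x => ?_).congr fun a => ?_
  · have := hT (a, x)
    simp only [bits_prod] at this
    simp [bits_cons]; omega
  · rw [List.foldl_reverse]
    induction l a <;> simp_all

theorem filter {l : α → List β} {c : α → β → Bool} (hl : Comp μ l)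
    (hc : PT fun p : α × β => c p.1 p.2) : Comp μ fun a => (l a).filter (c a) := by
  refine (foldl_of_bits_add (step := fun a (s : List β) x => if c a x then x :: s else s) (T := .X + 1)
    (ite (isTrue (PT.comp₂ hc Comp.id.fst Comp.id.snd.snd)) (cons Comp.id.snd.snd Comp.id.snd.fst)
      Comp.id.snd.fst) hl.reverse (const hl.bits_input []) fun a s x => ?_).congr fun a => ?_
  · split
    · simp [bits_cons]; omega
    · simp
  · rw [List.foldl_reverse]
    induction l a with
    | nil => rfl
    | cons x l ih => simp only [List.foldr_cons, ih, List.filter_cons]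

theorem any {l : α → List β} {c : α → β → Bool} (hl : Comp μ l)
    (hc : PT fun p : α × β => c p.1 p.2) : Comp μ fun a => (l a).any (c a) := by
  refine (foldl_of_bits_add (step := fun a (s : Bool) x => if c a x then true else s) (T := 2)
    (ite (isTrue (PT.comp₂ hc Comp.id.fst Comp.id.snd.snd)) (const Comp.id.bits_input true)
      Comp.id.snd.fst) hl.reverse (const hl.bits_input false) fun a s x => ?_).congr fun a => ?_
  · have := bits_bool (if c a x then true else s)
    have : Polynomial.eval (bits a + bits x) (2 : Polynomial ℕ) = 2 := by simp
    omega
  · rw [List.foldl_reverse]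
    induction l a with
    | nil => rfl
    | cons x l ih => rw [List.foldr_cons, ih, List.any_cons]; cases c a x <;> simp

theorem flatMap {l : α → List β} {f : α → β → List γ} (hl : Comp μ l)
    (hf : PT fun p : α × β => f p.1 p.2) : Comp μ fun a => (l a).flatMap (f a) := by
  obtain ⟨T, hT⟩ := hf.bits_output
  refine (foldl_of_bits_add (step := fun a (s : List γ) x => f a x ++ s)
    (T := T.comp (.X + 1))
    (append (PT.comp₂ hf Comp.id.fst Comp.id.snd.snd) Comp.id.snd.fst) hl.reverse
    (const hl.bits_input []) fun a s x => ?_).congr fun a => ?_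
  · have := hT (a, x)
    have := bits_append (f a x) s
    simp only [bits_prod] at *
    simp; omega
  · rw [List.foldl_reverse]
    induction l a <;> simp_all

theorem sum {l : α → List ℕ} (hl : Comp μ l) : Comp μ fun a => (l a).sum :=
  (foldl_of_bits_add (step := fun (_ : α) (s : ℕ) x => s + x) (T := .X)
    (add Comp.id.snd.fst Comp.id.snd.snd) hl (const hl.bits_input 0) fun a s x => by
      have := bits_add_le s x
      simp; omega).congr fun a => by rw [List.sum_eq_foldl]

theorem listProd {l : α → List ℕ} (hl : Comp μ l) : Comp μ fun a => (l a).prod :=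
  (foldl_of_bits_add (step := fun (_ : α) (s : ℕ) x => s * x) (T := .X)
    (mul Comp.id.snd.fst Comp.id.snd.snd) hl (const hl.bits_input 1) fun a s x => by
      have := bits_mul_le s x
      simp; omega).congr fun a => by rw [List.prod_eq_foldl]

theorem length {l : α → List β} (hl : Comp μ l) : Comp μ fun a => (l a).length :=
  (sum (map (f := fun _ _ => 1) hl (PT.const 1))).congr fun a => by simp

/-- The bits added in a round include those of the counter, which belongs to the state, so
`foldl_of_bits_add` does not apply. The counter never exceeds the length of the list, which gives
the bound for `foldl`. -/
theorem zipIdx {l : α → List β} (hl : Comp μ l) : Comp μ fun a => (l a).zipIdx := by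
  have key : ∀ (l : List β) (s : List (β × ℕ)) k,
      l.foldl (fun s x => ((x, s.2) :: s.1, s.2 + 1)) (s, k) =
        ((l.zipIdx k).reverse ++ s, k + l.length) := by
    intro l
    induction l with
    | nil => simp
    | cons x l ih => intro s k; simp [ih]; omega
  have hB := hl.bits_output
  refine (reverse (fst (foldl (l := l) (init := fun _ => (([] : List (β × ℕ)), 0))
    (step := fun (_ : α) s x => ((x, s.2) :: s.1, s.2 + 1)) (ν := bits)
    (prod (cons (prod Comp.id.snd.snd Comp.id.snd.fst.snd) Comp.id.snd.fst.fst)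
      (add Comp.id.snd.fst.snd (const Comp.id.bits_input 1)))
    hl (const hl.bits_input _)
    (B := fun a => bits a + bits (l a) * (bits (l a) + bits (l a) + 3) + bits (l a) + bits (l a) + 5)
    ((((hl.bits_input.add (hB.mul ((hB.add hB).add (.const 3)))).add hB).add hB).add (.const 5))
    fun a l₁ x l₂ h => ?_))).congr fun a => by simp [key]
  have hx : bits x ≤ bits (l a) := bits_le_of_mem (by simp [h])
  have hlen : l₁.length ≤ bits (l a) := by
    have := length_lt_bits (l a)
    rw [h] at this ⊢
    simp only [List.length_append] at this
    omega
  have hk : ∀ k ≤ l₁.length, bits k ≤ bits (l a) + 1 := fun k hk => by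
    have h1 := (Nat.size_le (m := k) (n := k)).2 Nat.lt_two_pow_self
    rw [bits_nat]; omega
  have hz : bits l₁.zipIdx.reverse ≤ l₁.length * (bits (l a) + bits (l a) + 3) + 1 := by
    have := bits_list_le (l := l₁.zipIdx.reverse) (B := bits (l a) + bits (l a) + 2) fun y hy => ?_
    · simpa using this
    · obtain ⟨y, k⟩ := y
      simp only [List.mem_reverse, List.mk_mem_zipIdx_iff_getElem?] at hy
      have h1 : bits y ≤ bits (l a) := by
        refine bits_le_of_mem ?_
        rw [h]
        exact List.mem_append_left _ (List.mem_of_getElem? hy)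
      have h2 := hk k (List.getElem?_eq_some_iff.1 hy).1.le
      simp only [bits_prod]; omega
  have := hk _ le_rfl
  have := Nat.mul_le_mul_right (bits (l a) + bits (l a) + 3) hlen
  simp only [key, bits_prod, List.append_nil, zero_add]
  omega

end Comp

/-- Equality of two lists, by a loop over the first one. -/
def listEq (l l' : List ℕ) : Bool :=
  let s := l.foldl (fun s x => (s.1.tail, if s.2 = true ∧ ¬ s.1 = [] ∧ s.1.headD 0 = x then true else false))
    (l', true)
  if s.2 = true ∧ s.1 = [] then true else false

theorem listEq_eq_decide (l l' : List ℕ) : listEq l l' = decide (l = l') := by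
  -- Once the flag is lost it is never regained.
  have hfalse : ∀ (l l' : List ℕ), (l.foldl (fun s x => (s.1.tail,
      if s.2 = true ∧ ¬ s.1 = [] ∧ s.1.headD 0 = x then true else false)) (l', false)).2 = false := by
    intro l
    induction l with
    | nil => simp
    | cons x l ih => intro l'; simpa using ih l'.tail
  induction l generalizing l' with
  | nil => cases l' <;> simp [listEq]
  | cons x l ih =>
    cases l' with
    | nil =>
      have := hfalse l []
      simp_all [listEq]
    | cons y l' =>
      by_cases h : y = x
      · subst h
        have := ih l'
        simp_all [listEq]
      · have := hfalse l l'
        have h' : ¬ x = y := fun h' => h h'.symm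
        simp_all [listEq]

theorem Comp.list_eq {α : Type} [ToVal α] {μ : α → ℕ} {l l' : α → List ℕ} (hl : Comp μ l)
    (hl' : Comp μ l') : Comp μ fun a => decide (l a = l' a) := by
  have h : PT fun p : List ℕ × List ℕ => listEq p.1 p.2 := by
    have hs := (Comp.id (α := (List ℕ × List ℕ) × (List ℕ × Bool) × ℕ)).snd
    have h := Comp.foldl_of_bits_add (T := 3) (l := fun p : List ℕ × List ℕ => p.1)
      (init := fun p => (p.2, true))
      (step := fun _ s x =>
        (s.1.tail, if s.2 = true ∧ ¬ s.1 = [] ∧ s.1.headD 0 = x then true else false))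
      ((PT.tail.comp hs.fst.fst).prod (.ite (hs.fst.snd.isTrue.and (hs.fst.fst.eq_nil.not.and
        ((PT.headD.comp hs.fst.fst).eq hs.snd))) (.const Comp.id.bits_input _)
          (.const Comp.id.bits_input _)))
      Comp.id.fst (Comp.id.snd.prod (.const Comp.id.bits_input _)) fun a s x => by
        have h1 := bits_le_of_sublist s.1.tail_sublist
        have h2 := bits_bool
          (if s.2 = true ∧ ¬ s.1 = [] ∧ s.1.headD 0 = x then true else false)
        have h3 : Polynomial.eval (bits a + bits x) (3 : Polynomial ℕ) = 3 := by
          exact Polynomial.eval_ofNat _ _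
        simp only [bits_prod] at *
        omega
    exact .ite (h.snd.isTrue.and h.fst.eq_nil) (.const Comp.id.bits_input _)
      (.const Comp.id.bits_input _)
  exact (PT.comp₂ h hl hl').congr fun a => listEq_eq_decide _ _

/-- The powers of two that are at most `x`, in decreasing order. -/
def twoPowers (x : ℕ) : List ℕ := ((List.range (Nat.size x)).map fun k => 2 ^ k).reverse

theorem mem_twoPowers {x p : ℕ} : p ∈ twoPowers x ↔ p ≤ x ∧ ∃ k, p = 2 ^ k := by
  simp only [twoPowers, List.mem_reverse, List.mem_map, List.mem_range, Nat.lt_size]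
  constructor
  · rintro ⟨k, hk, rfl⟩
    exact ⟨hk, k, rfl⟩
  · rintro ⟨hk, k, rfl⟩
    exact ⟨k, hk, rfl⟩

/-- `x` is halved until it vanishes, which takes `Nat.size x` rounds, while the current power is
doubled and recorded. -/
theorem PT.twoPowers : PT twoPowers := by
  let s : ℕ → ℕ → ℕ × ℕ × List ℕ := fun x t =>
    (x / 2 ^ t, 2 ^ t, ((List.range t).map fun k => 2 ^ k).reverse)
  have hi := Comp.id (α := ℕ × ℕ × List ℕ)
  have hx := Comp.id (α := ℕ)
  have hsize : PolyBdd bits Nat.size := PolyBdd.self.mono fun a => Nat.le_succ _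
  refine (Comp.snd (Comp.snd (Comp.iterate (s := s) (N := Nat.size) (c := fun s => decide (¬ s.1 = 0))
    (p := fun s => (s.1 / 2, s.2.1 + s.2.1, s.2.1 :: s.2.2))
    (hi.fst.eq (.const hi.bits_input 0)).not
    ((hi.fst.div (.const hi.bits_input 2)).prod ((hi.snd.fst.add hi.snd.fst).prod
      (hi.snd.fst.cons hi.snd.snd)))
    (fun x t ht => ?_) (fun x t ht => ?_) (fun x => ?_)
    -- The first component is `x / 1`, so that the initial state is definitionally `s x 0`.
    ((hx.div (.const hx.bits_input 1)).prod ((Comp.const hx.bits_input 1).prod (.const hx.bits_input [])))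
    hsize (B := fun x => bits x + (bits x + 1) + (bits x * (bits x + 2) + 1) + 2)
    (((PolyBdd.self.add (PolyBdd.self.add (.const 1))).add ((PolyBdd.self.mul
      (PolyBdd.self.add (.const 2))).add (.const 1))).add (.const 2)) fun x t ht => ?_)))
  · simp only [s, Prod.mk.injEq]
    refine ⟨by rw [pow_succ, Nat.div_div_eq_div_mul], by ring, ?_⟩
    simp [List.range_succ]
  · have : 2 ^ t ≤ x := Nat.lt_size.1 ht
    have : x / 2 ^ t ≠ 0 := (Nat.div_pos this (by positivity)).ne'
    exact decide_eq_true this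
  · have := Nat.lt_size_self x
    simpa [s] using this
  · have hp : ∀ k ≤ t, bits (2 ^ k) ≤ bits x + 1 := fun k hk => by
      simp only [bits_nat, Nat.size_pow]; omega
    have h1 : _ ≤ _ * (bits x + 2) + 1 := bits_list_le
      (l := ((List.range t).map fun k => 2 ^ k).reverse) (B := bits x + 1)
      (by simpa using fun k hk => hp k (by omega))
    have h2 := bits_mono (Nat.div_le_self x (2 ^ t))
    have h3 := hp t le_rfl
    have h4 : t * (bits x + 2) ≤ bits x * (bits x + 2) :=
      Nat.mul_le_mul_right _ (by rw [bits_nat]; omega)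
    simp only [List.length_reverse, List.length_map, List.length_range] at h1
    simp only [s, bits_prod]
    omega

/-! ## The dynamic program -/

/-- A job: its rounded load, its index, its load. -/
abbrev Job : Type := ℕ × ℕ × ℕ

/-- A partial schedule: the jobs that are not assigned, the jobs that are assigned, each with its
machine, and the rounded load of the machine under consideration. -/
abbrev Partial : Type := List Job × List (Job × ℕ) × ℕ

/-- The data of one stage of the dynamic program: the accuracy `1 / q`, the makespan `T`, the list
of all jobs, and the machine under consideration, given by its processing time and its index. -/
abbrev Stage : Type := (ℕ × ℕ × List Job) × ℕ × ℕ

namespace Stage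

abbrev q (p : Stage) : ℕ := p.1.1
abbrev T (p : Stage) : ℕ := p.1.2.1
abbrev jobs (p : Stage) : List Job := p.1.2.2
abbrev time (p : Stage) : ℕ := p.2.1
abbrev machine (p : Stage) : ℕ := p.2.2

/-- Jobs that take more than the fraction `1 / q` of the makespan, but not more than all of it. -/
abbrev IsLarge (p : Stage) (r : ℕ) : Prop := p.T < p.q * (p.time * r) ∧ p.time * r ≤ p.T

/-- Partial schedules with the same key are interchangeable, up to their volumes. -/
def key (p : Stage) (s : Partial) : List ℕ × ℕ :=
  (p.jobs.map fun x => if p.IsLarge x.1 then (s.1.filter fun y => decide (y.1 = x.1)).length else 0,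
    s.2.2)

/-- The total load of the jobs that are not assigned. -/
def volume (s : Partial) : ℕ := (s.1.map fun x => x.1).sum

/-- Assign the job `x` to the machine under consideration. -/
def place (p : Stage) (s : Partial) (x : Job) : Partial :=
  (s.1.filter fun y => decide (¬ y.2.1 = x.2.1), (x, p.machine) :: s.2.1, s.2.2 + x.1)

/-- Add `s` to the list `l`, which keeps for every key only one partial schedule of minimum volume. -/
def insert (p : Stage) (l : List Partial) (s : Partial) : List Partial :=
  if l.any fun s' => decide (((p.key s').1 = (p.key s).1 ∧ (p.key s').2 = (p.key s).2) ∧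
    volume s' ≤ volume s)
  then l
  else s :: l.filter fun s' => decide (¬ ((p.key s').1 = (p.key s).1 ∧ (p.key s').2 = (p.key s).2))

/-- Assign at most one large job to the machine, in all possible ways. -/
def candidates (p : Stage) (s : Partial) : List Partial :=
  s :: (s.1.filter fun x => decide (p.IsLarge x.1 ∧ p.time * (s.2.2 + x.1) ≤ p.T)).map (p.place s)

/-- Merging after every single job, instead of once after all choices of large jobs, keeps the
intermediate lists short. -/
def expand (p : Stage) (l : List Partial) : List Partial :=
  (l.flatMap p.candidates).foldl p.insert []

/-- Assign the small job `x` unless the machine is full already; otherwise put it aside. -/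
def pour (p : Stage) (s : Partial) (x : Job) : Partial :=
  if p.q * (p.time * x.1) ≤ p.T ∧ p.time * s.2.2 ≤ p.T
  then (s.1, (x, p.machine) :: s.2.1, s.2.2 + x.1)
  else (x :: s.1, s.2)

/-- The jobs put aside pile up in reverse order; reversing them keeps the unassigned jobs a sublist
of the job list. -/
def fill (p : Stage) (s : Partial) : Partial :=
  ((s.1.foldl p.pour ([], s.2)).1.reverse, (s.1.foldl p.pour ([], s.2)).2)

/-- The partial schedules after all choices of large jobs for the machine. -/
def largeStep (p : Stage) (l : List Partial) : List Partial :=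
  p.jobs.foldl (fun l _ => p.expand l) (l.map fun s => (s.1, s.2.1, 0))

def step (p : Stage) (l : List Partial) : List Partial := (p.largeStep l).map p.fill

end Stage

/-- The accuracy, the makespan, the list of jobs, and the list of machines. -/
abbrev SearchInput : Type := (ℕ × ℕ × List Job) × List (ℕ × ℕ)

/-- The partial schedules after all the machines. -/
def search (e : SearchInput) : List Partial :=
  e.2.foldl (fun l M => Stage.step (e.1, M) l) [(e.1.2.2, [], 0)]

/-! ### Running time of the search in terms of the sizes of its intermediate lists. -/

namespace Stage

open Comp (const)

theorem pt_isLarge : PT fun a : Stage × ℕ => decide (a.1.IsLarge a.2) :=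
  have h := Comp.id (α := Stage × ℕ)
  (h.fst.fst.snd.fst.lt (h.fst.fst.fst.mul (h.fst.snd.fst.mul h.snd))).and
    ((h.fst.snd.fst.mul h.snd).le h.fst.fst.snd.fst)

theorem pt_key : PT fun a : Stage × Partial => a.1.key a.2 := by
  have h := Comp.id (α := Stage × Partial)
  have h' := Comp.id (α := (Stage × Partial) × Job)
  have h'' := Comp.id (α := ((Stage × Partial) × Job) × Job)
  exact ((h.fst.fst.snd.snd).map (.ite (pt_isLarge.comp (h'.fst.fst.prod h'.snd.fst))
    (h'.fst.snd.fst.filter (h''.snd.fst.eq h''.fst.snd.fst)).length (const h'.bits_input 0))).prod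
    h.snd.snd.snd

theorem pt_volume : PT volume := (Comp.id.fst.map Comp.id.snd.fst).sum

theorem pt_place : PT fun a : Stage × Partial × Job => a.1.place a.2.1 a.2.2 :=
  have h := Comp.id (α := Stage × Partial × Job)
  have h' := Comp.id (α := (Stage × Partial × Job) × Job)
  (h.snd.fst.fst.filter (h'.snd.snd.fst.eq h'.fst.snd.snd.snd.fst).not).prod
    (((h.snd.snd.prod h.fst.snd.snd).cons h.snd.fst.snd.fst).prod (h.snd.fst.snd.snd.add h.snd.snd.fst))

theorem pt_insert : PT fun a : Stage × List Partial × Partial => a.1.insert a.2.1 a.2.2 := by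
  have h := Comp.id (α := Stage × List Partial × Partial)
  have h' := Comp.id (α := (Stage × List Partial × Partial) × Partial)
  have hk := PT.comp₂ pt_key h'.fst.fst h'.snd
  have hk' := PT.comp₂ pt_key h'.fst.fst h'.fst.snd.snd
  have he := (hk.fst.list_eq hk'.fst).and (hk.snd.eq hk'.snd)
  exact .ite (h.snd.fst.any (he.and ((pt_volume.comp h'.snd).le (pt_volume.comp h'.fst.snd.snd)))).isTrue
    h.snd.fst (h.snd.snd.cons (h.snd.fst.filter he.not))

theorem pt_candidates : PT fun a : Stage × Partial => a.1.candidates a.2 := by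
  have h := Comp.id (α := Stage × Partial)
  have h' := Comp.id (α := (Stage × Partial) × Job)
  exact h.snd.cons ((h.snd.fst.filter ((pt_isLarge.comp (h'.fst.fst.prod h'.snd.fst)).and
    ((h'.fst.fst.snd.fst.mul (h'.fst.snd.snd.snd.add h'.snd.fst)).le h'.fst.fst.fst.snd.fst))).map
      (pt_place.comp (h'.fst.fst.prod (h'.fst.snd.prod h'.snd))))

theorem pt_expand : PT fun a : Stage × List Partial => a.1.expand a.2 := by
  have h := Comp.id (α := Stage × List Partial)
  have h' := Comp.id (α := (Stage × List Partial) × Partial)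
  have h'' := Comp.id (α := (Stage × List Partial) × List Partial × Partial)
  refine Comp.foldl_of_bits_add (T := .X + 1) (step := fun (a : Stage × List Partial) => a.1.insert)
    (pt_insert.comp (h''.fst.fst.prod (h''.snd.fst.prod h''.snd.snd)))
    (h.snd.flatMap (pt_candidates.comp (h'.fst.fst.prod h'.snd))) (const h.bits_input [])
    fun a l s => ?_
  have hT : Polynomial.eval (bits a + bits s) (.X + 1 : Polynomial ℕ) = bits a + bits s + 1 := by simp
  rw [hT]
  unfold insert
  split
  · omega
  · rw [bits_cons]
    have := bits_le_of_sublist (List.filter_sublist (l := l) (p := fun s' =>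
      decide (¬ ((a.1.key s').1 = (a.1.key s).1 ∧ (a.1.key s').2 = (a.1.key s).2))))
    omega

theorem pt_pour : PT fun a : Stage × Partial × Job => a.1.pour a.2.1 a.2.2 := by
  have h := Comp.id (α := Stage × Partial × Job)
  exact .ite (((h.fst.fst.fst.mul (h.fst.snd.fst.mul h.snd.snd.fst)).le h.fst.fst.snd.fst).and
    ((h.fst.snd.fst.mul h.snd.fst.snd.snd).le h.fst.fst.snd.fst))
    (h.snd.fst.fst.prod (((h.snd.snd.prod h.fst.snd.snd).cons h.snd.fst.snd.fst).prod
      (h.snd.fst.snd.snd.add h.snd.snd.fst)))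
    ((h.snd.snd.cons h.snd.fst.fst).prod h.snd.fst.snd)

theorem pt_fill : PT fun a : Stage × Partial => a.1.fill a.2 := by
  have h := Comp.id (α := Stage × Partial)
  have h' := Comp.id (α := (Stage × Partial) × Partial × Job)
  have hs : Comp bits fun a : Stage × Partial => a.2.2 := h.snd.snd
  have hi : Comp bits fun a : Stage × Partial => (([] : List Job), a.2.2) :=
    .prod (const h.bits_input []) hs
  have hfold : Comp bits fun a : Stage × Partial => a.2.1.foldl a.1.pour ([], a.2.2) := by
    refine Comp.foldl_of_bits_add (T := .X + .X + 2) (step := fun (a : Stage × Partial) => a.1.pour)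
      (pt_pour.comp (h'.fst.fst.prod h'.snd)) h.snd.fst hi fun a s x => ?_
    have hT : Polynomial.eval (bits a + bits x) (.X + .X + 2 : Polynomial ℕ) =
      bits a + bits x + (bits a + bits x) + 2 := by simp
    have h1 := bits_add_le s.2.2 x.1
    have h2 := bits_prod a
    have h3 := bits_prod a.1
    have h4 := bits_prod a.1.2
    have h5 := bits_prod x
    rw [hT]
    unfold pour
    split
    · rw [bits_prod, bits_prod, bits_prod s, bits_prod s.2, bits_cons, bits_prod]
      simp only [machine] at *
      omega
    · change bits (x :: s.1) + bits s.2 + 1 ≤ _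
      rw [bits_prod s, bits_cons]
      omega
  exact hfold.fst.reverse.prod hfold.snd

/-- The states of the loop in `largeStep`. -/
def largeState (p : Stage) (l : List Partial) (t : ℕ) : List Partial :=
  p.expand^[t] (l.map fun s => (s.1, s.2.1, 0))

theorem foldl_const_expand (p : Stage) (J : List Job) (l : List Partial) :
    J.foldl (fun l _ => p.expand l) l = p.expand^[J.length] l := by
  induction J generalizing l with
  | nil => rfl
  | cons x J ih => rw [List.foldl_cons, ih, List.length_cons, Function.iterate_succ_apply]

theorem foldl_largeState (p : Stage) (l : List Partial) (J : List Job) :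
    J.foldl (fun l _ => p.expand l) (l.map fun s => (s.1, s.2.1, 0)) = p.largeState l J.length :=
  p.foldl_const_expand J _

/-- The time for `step`, up to a polynomial. -/
def stepCost (a : Stage × List Partial) : ℕ :=
  bits a + ∑ t ∈ Finset.range (a.1.jobs.length + 1), bits (a.1.largeState a.2 t)

/-- No bound for the number of partial schedules is available yet, so the time is measured by the
lists that actually occur. -/
theorem comp_step : Comp stepCost fun a => a.1.step a.2 := by
  have h₀ := Comp.id (α := (Stage × List Partial) × Partial)
  have h₁ := Comp.id (α := (Stage × List Partial) × List Partial × Job)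
  have hbits : PolyBdd stepCost bits := PolyBdd.self.mono fun a => Nat.le_add_right _ _
  have h := Comp.mono Comp.id hbits
  have hl : Comp stepCost fun a => a.1.largeStep a.2 := by
    refine Comp.foldl (ν := bits) (step := fun a l _ => a.1.expand l)
      (pt_expand.comp (h₁.fst.fst.prod h₁.snd.fst)) h.fst.fst.snd.snd
      (h.snd.map (h₀.snd.fst.prod (h₀.snd.snd.fst.prod (const h₀.bits_input 0))))
      (B := fun a => stepCost a + bits a + 2) ((PolyBdd.self.add hbits).add (.const 2)) ?_
    intro a l₁ x l₂ hx
    have h1 : bits x ≤ bits a := by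
      have : bits x ≤ bits a.1.1.2.2 := bits_le_of_mem (by simp [hx])
      simp only [bits_prod] at *
      omega
    have h2 := Finset.single_le_sum (f := fun t => bits (a.1.largeState a.2 t))
      (fun _ _ => Nat.zero_le _) (show l₁.length ∈ Finset.range (a.1.jobs.length + 1) by
        simp [hx])
    rw [foldl_largeState]
    change bits a + (bits (a.1.largeState a.2 l₁.length) + bits x + 1) + 1 ≤
      bits a + (∑ t ∈ Finset.range (a.1.jobs.length + 1), bits (a.1.largeState a.2 t)) + bits a + 2
    omega
  exact Comp.comp (ν := bits) (g := fun x : Stage × List Partial => x.2.map x.1.fill)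
    (Comp.id.snd.map (pt_fill.comp (h₀.fst.fst.prod h₀.snd))) (h.fst.prod hl)
    (h.fst.prod hl).bits_output

end Stage

theorem comp_search_of_bits_le {ν : SearchInput → ℕ} (hbits : PolyBdd ν bits)
    {B : SearchInput → ℕ} (hB : PolyBdd ν B)
    (h : ∀ e l₁ M, l₁ ++ [M] <+: e.2 → ∀ t ≤ e.1.2.2.length,
      bits (Stage.largeState (e.1, M) (search (e.1, l₁)) t) ≤ B e)
    (h' : ∀ e l₁, l₁ <+: e.2 → bits (search (e.1, l₁)) ≤ B e) : Comp ν search := by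
  have hid := Comp.mono Comp.id hbits
  have hi := Comp.id (α := SearchInput × List Partial × ℕ × ℕ)
  refine Comp.foldl (step := fun e l M => Stage.step (e.1, M) l)
    (ν := fun x => bits x + Stage.stepCost ((x.1.1, x.2.2), x.2.1)) ?_ hid.snd
    ((hid.fst.snd.snd.prod (.const hbits _)).cons (.const hbits []))
    (B := fun e => 2 * (bits e + B e + bits e + 2) + (bits e + 1) * B e) ?_ ?_
  · have hb : PolyBdd (fun x : SearchInput × List Partial × ℕ × ℕ =>
        bits x + Stage.stepCost ((x.1.1, x.2.2), x.2.1)) bits :=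
      PolyBdd.self.mono fun x => Nat.le_add_right _ _
    have hj := Comp.mono hi hb
    exact Stage.comp_step.comp ((hj.fst.fst.prod hj.snd.snd).prod hj.snd.fst)
      (PolyBdd.self.mono fun x => Nat.le_add_left _ _)
  · exact ((PolyBdd.const 2).mul (((hbits.add hB).add hbits).add (.const 2))).add
      ((hbits.add (.const 1)).mul hB)
  · intro e l₁ M l₂ he
    have h1 : bits M ≤ bits e.2 := bits_le_of_mem (by simp [he])
    have h2 := h' e l₁ ⟨_, he.symm⟩
    have h3 := h e l₁ M ⟨l₂, by simp [he]⟩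
    have h4 := length_lt_bits e.1.2.2
    have h5 := Finset.sum_le_card_nsmul (Finset.range (e.1.2.2.length + 1))
      (fun t => bits (Stage.largeState (e.1, M) (search (e.1, l₁)) t)) (B e)
      fun t ht => h3 t (by simpa [Nat.lt_succ_iff] using ht)
    have h6 := bits_prod e
    have h7 := bits_prod e.1
    have h8 := bits_prod e.1.2
    have h9 : (e.1.2.2.length + 1) * B e ≤ (bits e + 1) * B e := Nat.mul_le_mul_right _ (by omega)
    simp only [Finset.card_range, smul_eq_mul] at h5
    change bits e + (bits (search (e.1, l₁)) + bits M + 1) + 1 +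
      (bits e.1 + bits M + 1 + bits (search (e.1, l₁)) + 1 + ∑ t ∈ Finset.range
        (e.1.2.2.length + 1), bits (Stage.largeState (e.1, M) (search (e.1, l₁)) t)) ≤ _
    omega

theorem bits_sum_le (l : List ℕ) : bits l.sum ≤ bits l := by
  induction l with
  | nil => simp [bits_nat, bits_nil]
  | cons x l ih =>
    have := bits_add_le x l.sum
    rw [List.sum_cons, bits_cons]; omega

theorem bits_volume_le (s : Partial) : bits (Stage.volume s) ≤ bits s.1 := by
  refine (bits_sum_le _).trans ?_
  induction s.1 with
  | nil => rfl
  | cons x l ih => rw [List.map_cons, bits_cons, bits_cons, bits_prod]; omega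

theorem List.sum_map_filter_add_le {α : Type*} (f : α → ℕ) (c : α → Bool) {l : List α} {x : α}
    (hx : x ∈ l) (hc : c x = false) : ((l.filter c).map f).sum + f x ≤ (l.map f).sum := by
  have hle : ∀ l : List α, ((l.filter c).map f).sum ≤ (l.map f).sum := fun l =>
    (List.filter_sublist.map f).sum_le_sum fun _ _ => Nat.zero_le _
  induction l with
  | nil => simp at hx
  | cons y l ih =>
    rcases List.mem_cons.1 hx with rfl | hx
    · have := hle l
      simp only [List.filter_cons, hc, List.map_cons, List.sum_cons]
      simp only [Bool.false_eq_true, if_false]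
      omega
    · have := ih hx
      rw [List.filter_cons]
      split <;> simp only [List.map_cons, List.sum_cons] <;> omega

/-! ### Number and size of the partial schedules that are kept. -/

namespace Stage

/-- The loads of the large jobs of a stage. -/
def largeLoads (p : Stage) : Finset ℕ := (p.jobs.map fun x => x.1).toFinset.filter p.IsLarge

theorem mem_of_mem_insert {p : Stage} {l : List Partial} {s s' : Partial} (h : s' ∈ p.insert l s) :
    s' = s ∨ s' ∈ l := by
  unfold insert at h
  split at h
  · exact .inr h
  · rcases List.mem_cons.1 h with h | h
    · exact .inl h
    · exact .inr (List.mem_filter.1 h).1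

theorem mem_of_mem_foldl_insert {p : Stage} {l l' : List Partial} {s : Partial}
    (h : s ∈ l'.foldl p.insert l) : s ∈ l ∨ s ∈ l' := by
  induction l' generalizing l with
  | nil => exact .inl h
  | cons x l' ih =>
    rcases ih h with h | h
    · rcases mem_of_mem_insert h with rfl | h
      · exact .inr List.mem_cons_self
      · exact .inl h
    · exact .inr (List.mem_cons_of_mem _ h)

theorem mem_expand {p : Stage} {l : List Partial} {s : Partial} (h : s ∈ p.expand l) :
    ∃ s' ∈ l, s = s' ∨ ∃ x ∈ s'.1, p.IsLarge x.1 ∧ p.time * (s'.2.2 + x.1) ≤ p.T ∧ s = p.place s' x := by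
  rcases mem_of_mem_foldl_insert h with h | h
  · simp at h
  · obtain ⟨s', hs', h⟩ := List.mem_flatMap.1 h
    refine ⟨s', hs', ?_⟩
    rcases List.mem_cons.1 h with h | h
    · exact .inl h
    · obtain ⟨x, hx, rfl⟩ := List.mem_map.1 h
      obtain ⟨hx, h⟩ := List.mem_filter.1 hx
      have := of_decide_eq_true h
      exact .inr ⟨x, hx, this.1, this.2, rfl⟩

theorem nodup_insert {p : Stage} {l : List Partial} (h : (l.map p.key).Nodup) (s : Partial) :
    ((p.insert l s).map p.key).Nodup := by
  unfold insert
  split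
  · exact h
  · rw [List.map_cons, List.nodup_cons]
    refine ⟨fun hs => ?_, h.sublist (List.filter_sublist.map _)⟩
    obtain ⟨s', hs', he⟩ := List.mem_map.1 hs
    have := of_decide_eq_true (List.mem_filter.1 hs').2
    exact this (by rw [he]; exact ⟨rfl, rfl⟩)

theorem nodup_expand (p : Stage) (l : List Partial) : ((p.expand l).map p.key).Nodup := by
  unfold expand
  suffices h : ∀ l l' : List Partial, (l'.map p.key).Nodup →
    ((l.foldl p.insert l').map p.key).Nodup from h _ _ (by simp)
  intro l
  induction l with
  | nil => exact fun _ h => h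
  | cons s l ih => exact fun l' h => ih _ (nodup_insert h s)

/-- The load of the machine under consideration comes from large jobs. -/
def LargeOnly (p : Stage) (s : Partial) : Prop :=
  s.1.Sublist p.jobs ∧ ∃ g : p.largeLoads → ℕ, s.2.2 = ∑ r : p.largeLoads, (r : ℕ) * g r ∧
    ∑ r, g r + s.1.length ≤ p.jobs.length

theorem LargeOnly.place {p : Stage} {s : Partial} (h : p.LargeOnly s) {x : Job} (hx : x ∈ s.1)
    (hl : p.IsLarge x.1) : p.LargeOnly (p.place s x) := by
  obtain ⟨hs, g, hg, hm⟩ := h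
  have hmem : x.1 ∈ p.largeLoads :=
    Finset.mem_filter.2 ⟨by simpa using ⟨_, _, hs.subset hx⟩, hl⟩
  refine ⟨List.filter_sublist.trans hs, fun r => g r + if r = ⟨x.1, hmem⟩ then 1 else 0, ?_, ?_⟩
  · simp [mul_add, Finset.sum_add_distrib, Stage.place, hg]
  · have := List.sum_map_filter_add_le (fun _ => 1) (fun y : Job => decide (¬ y.2.1 = x.2.1)) hx
      (by simp)
    simp only [List.map_const', List.sum_replicate, smul_eq_mul, mul_one] at this
    simp only [Finset.sum_add_distrib, Finset.sum_ite_eq', Finset.mem_univ, if_true, Stage.place]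
    omega

theorem largeOnly_largeState {p : Stage} {l : List Partial} (h : ∀ s ∈ l, s.1.Sublist p.jobs) (t : ℕ) :
    ∀ s ∈ p.largeState l t, p.LargeOnly s := by
  induction t with
  | zero =>
    intro s hs
    obtain ⟨s', hs', rfl⟩ := List.mem_map.1 hs
    exact ⟨h s' hs', 0, by simp, by simpa using (h s' hs').length_le⟩
  | succ t ih =>
    intro s hs
    rw [largeState, Function.iterate_succ_apply'] at hs
    obtain ⟨s', hs', rfl | ⟨x, hx, hl, -, rfl⟩⟩ := mem_expand hs
    · exact ih _ hs'
    · exact (ih _ hs').place hx hl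

/-- The number of keys. -/
def keyBound (p : Stage) : ℕ := (p.jobs.length + 1) ^ (2 * p.largeLoads.card)

/-- A key is determined by two functions from the large loads to `{0, …, m}`: the numbers of
unassigned jobs of each load, and the multiplicities with which the loads occur on the current
machine. Hence the exponent `2 * card`; as keys do not repeat, it remains to count these pairs. -/
theorem length_le_keyBound {p : Stage} {l : List Partial} (h : ∀ s ∈ l, p.LargeOnly s)
    (hl : (l.map p.key).Nodup) : l.length ≤ p.keyBound := by
  classical
  let m := p.jobs.length
  let Φ : (p.largeLoads → Fin (m + 1)) × (p.largeLoads → Fin (m + 1)) → List ℕ × ℕ := fun c =>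
    (p.jobs.map fun x => if h : x.1 ∈ p.largeLoads then (c.1 ⟨x.1, h⟩ : ℕ) else 0,
      ∑ r : p.largeLoads, (r : ℕ) * (c.2 r : ℕ))
  have hsub : (l.map p.key).toFinset ⊆ Finset.univ.image Φ := by
    intro k hk
    obtain ⟨s, hs, rfl⟩ := List.mem_map.1 (List.mem_toFinset.1 hk)
    obtain ⟨hs, g, hg, hm⟩ := h s hs
    have hf : ∀ r, (s.1.filter fun y => decide (y.1 = r)).length < m + 1 := fun r =>
      Nat.lt_succ_of_le ((List.length_filter_le _ _).trans hs.length_le)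
    have hg' : ∀ r, g r < m + 1 := fun r => by
      have := Finset.single_le_sum (f := g) (fun _ _ => Nat.zero_le _) (Finset.mem_univ r)
      omega
    refine Finset.mem_image.2 ⟨(fun r => ⟨_, hf r⟩, fun r => ⟨g r, hg' r⟩), Finset.mem_univ _, ?_⟩
    refine Prod.ext (List.map_congr_left fun x hx => ?_) hg.symm
    have : x.1 ∈ p.largeLoads ↔ p.IsLarge x.1 := by
      simp only [largeLoads, Finset.mem_filter, List.mem_toFinset, List.mem_map, and_iff_right_iff_imp]
      exact fun _ => ⟨x, hx, rfl⟩
    by_cases h : p.IsLarge x.1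
    · rw [dif_pos (this.2 h), if_pos h]
    · rw [dif_neg (mt this.1 h), if_neg h]
  have h1 := (Finset.card_le_card hsub).trans Finset.card_image_le
  rw [List.toFinset_card_of_nodup hl, List.length_map] at h1
  refine h1.trans_eq ?_
  simp [keyBound, m, two_mul, pow_add]

/-- The list for `t = 0` comes from the previous stage without merging, so the bound for it is
assumed; all later lists have distinct keys. -/
theorem length_largeState_le {p : Stage} {l : List Partial} (h : ∀ s ∈ l, s.1.Sublist p.jobs) {B : ℕ}
    (hl : l.length ≤ B) (hp : p.keyBound ≤ B) (t : ℕ) : (p.largeState l t).length ≤ B := by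
  cases t with
  | zero => simpa [largeState] using hl
  | succ t =>
    refine (length_le_keyBound (largeOnly_largeState h (t + 1)) ?_).trans hp
    rw [largeState, Function.iterate_succ_apply']
    exact nodup_expand _ _

/-- Partial schedules of the jobs in `J` on machines in `Ms`; for a bound on their size. -/
def IsPartial (J : List Job) (Ms : List (ℕ × ℕ)) (s : Partial) : Prop :=
  s.1.Sublist J ∧ (∀ y ∈ s.2.1, y.1 ∈ J ∧ ∃ M ∈ Ms, y.2 = M.2) ∧ s.2.1.length + s.1.length ≤ J.length ∧
    s.2.2 + volume s ≤ volume (J, [], 0)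

theorem IsPartial.place {p : Stage} {Ms : List (ℕ × ℕ)} (hp : p.2 ∈ Ms) {s : Partial}
    (h : IsPartial p.jobs Ms s) {x : Job} (hx : x ∈ s.1) : IsPartial p.jobs Ms (p.place s x) := by
  obtain ⟨h1, h2, h3, h4⟩ := h
  refine ⟨List.filter_sublist.trans h1, ?_, ?_, ?_⟩
  · intro y hy
    rcases List.mem_cons.1 hy with rfl | hy
    · exact ⟨h1.subset hx, _, hp, rfl⟩
    · exact h2 y hy
  · have := List.sum_map_filter_add_le (fun _ => 1) (fun y : Job => decide (¬ y.2.1 = x.2.1)) hx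
      (by simp)
    simp only [List.map_const', List.sum_replicate, smul_eq_mul, mul_one] at this
    simp only [Stage.place, List.length_cons]
    omega
  · have := List.sum_map_filter_add_le (fun y => y.1) (fun y : Job => decide (¬ y.2.1 = x.2.1)) hx
      (by simp)
    simp only [Stage.place, volume] at *
    omega

/-- Putting a job aside does not alter the list of jobs put aside followed by the jobs still to be
seen. An invariant of `fill` thus has to be checked only when a small job is assigned to a machine
that is not yet full. -/
theorem fill_induction {p : Stage} {C : Partial → Prop} {s : Partial} (hs : C s)
    (h : ∀ U₁ x U₂ A L, p.q * (p.time * x.1) ≤ p.T → p.time * L ≤ p.T → C (U₁ ++ x :: U₂, A, L) →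
      C (U₁ ++ U₂, (x, p.machine) :: A, L + x.1)) : C (p.fill s) := by
  suffices h : ∀ (l : List Job) k, C (k.1.reverse ++ l, k.2) →
    C ((l.foldl p.pour k).1.reverse, (l.foldl p.pour k).2) from h s.1 ([], s.2) hs
  intro l
  induction l with
  | nil => intro k hk; simpa using hk
  | cons x l ih =>
    intro k hk
    refine ih _ ?_
    unfold pour
    split
    · rename_i hx
      exact h _ _ _ _ _ hx.1 hx.2 hk
    · simpa using hk

theorem isPartial_largeState {p : Stage} {Ms : List (ℕ × ℕ)} (hp : p.2 ∈ Ms) {l : List Partial}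
    (h : ∀ s ∈ l, IsPartial p.jobs Ms s) (t : ℕ) : ∀ s ∈ p.largeState l t, IsPartial p.jobs Ms s := by
  induction t with
  | zero =>
    intro s hs
    obtain ⟨s', hs', rfl⟩ := List.mem_map.1 hs
    obtain ⟨h1, h2, h3, h4⟩ := h s' hs'
    refine ⟨h1, h2, h3, ?_⟩
    simp only [volume] at *
    omega
  | succ t ih =>
    intro s hs
    rw [largeState, Function.iterate_succ_apply'] at hs
    obtain ⟨s', hs', rfl | ⟨x, hx, hl, -, rfl⟩⟩ := mem_expand hs
    · exact ih _ hs'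
    · exact (ih _ hs').place hp hx

theorem step_eq (p : Stage) (l : List Partial) :
    p.step l = (p.largeState l p.jobs.length).map p.fill := by
  rw [step, largeStep, foldl_largeState]

theorem isPartial_fill {p : Stage} {Ms : List (ℕ × ℕ)} (hp : p.2 ∈ Ms) {s : Partial}
    (h : IsPartial p.jobs Ms s) : IsPartial p.jobs Ms (p.fill s) := by
  refine fill_induction h fun U₁ x U₂ A L _ _ h => ?_
  obtain ⟨h1, h2, h3, h4⟩ := h
  refine ⟨.trans (by simp) h1, ?_, ?_, ?_⟩
  · intro y hy
    rcases List.mem_cons.1 hy with rfl | hy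
    · exact ⟨h1.subset (by simp), _, hp, rfl⟩
    · exact h2 y hy
  · simp only [List.length_append, List.length_cons] at *
    omega
  · simp only [volume, List.map_append, List.sum_append, List.map_cons, List.sum_cons] at *
    omega

end Stage

/-- The number of partial schedules that `search` keeps at any time. -/
def searchWidth (e : SearchInput) : ℕ :=
  (e.1.2.2.length + 1) ^ (2 * e.2.toFinset.sup fun M => (Stage.largeLoads (e.1, M)).card)

theorem keyBound_le_searchWidth {e : SearchInput} {M : ℕ × ℕ} (hM : M ∈ e.2) :
    Stage.keyBound (e.1, M) ≤ searchWidth e :=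
  Nat.pow_le_pow_right (Nat.succ_pos _) (Nat.mul_le_mul_left _
    (Finset.le_sup (f := fun M => (Stage.largeLoads (e.1, M)).card) (List.mem_toFinset.2 hM)))

theorem search_append (e : ℕ × ℕ × List Job) (l : List (ℕ × ℕ)) (M : ℕ × ℕ) :
    search (e, l ++ [M]) = Stage.step (e, M) (search (e, l)) := by
  simp [search]

/-- The width does not accumulate over the machines: each stage merges afresh, and `fill` maps the
list without lengthening it. -/
theorem search_bounds (e : SearchInput) {l : List (ℕ × ℕ)} (hl : l <+: e.2) :
    (search (e.1, l)).length ≤ searchWidth e ∧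
      ∀ s ∈ search (e.1, l), Stage.IsPartial e.1.2.2 e.2 s := by
  induction l using List.reverseRecOn with
  | nil =>
    refine ⟨Nat.one_le_pow _ _ (Nat.succ_pos _), fun s hs => ?_⟩
    obtain rfl := List.mem_singleton.1 hs
    exact ⟨List.Sublist.refl _, by simp, by simp, by simp [Stage.volume]⟩
  | append_singleton l M ih =>
    have hM : M ∈ e.2 := hl.subset (by simp)
    obtain ⟨h1, h2⟩ := ih ((List.prefix_append _ _).trans hl)
    rw [search_append, Stage.step_eq]
    refine ⟨?_, fun s hs => ?_⟩
    · rw [List.length_map]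
      exact Stage.length_largeState_le (fun s hs => (h2 s hs).1) h1 (keyBound_le_searchWidth hM) _
    · obtain ⟨s', hs', rfl⟩ := List.mem_map.1 hs
      exact Stage.isPartial_fill hM (Stage.isPartial_largeState (p := (e.1, M)) hM h2 _ _ hs')

theorem Stage.IsPartial.bits_le {J : List Job} {Ms : List (ℕ × ℕ)} {s : Partial}
    (h : Stage.IsPartial J Ms s) :
    bits s ≤ bits J + (bits J * (bits J + bits Ms + 2) + 1) + bits J + 2 := by
  obtain ⟨h1, h2, h3, h4⟩ := h
  have h5 := bits_list_le (l := s.2.1) (B := bits J + bits Ms + 1) fun y hy => by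
    obtain ⟨hy, M, hM, hi⟩ := h2 y hy
    have h1 := bits_le_of_mem hy
    have h2 := bits_le_of_mem hM
    rw [bits_prod] at h2 ⊢
    rw [hi]
    omega
  have h6 : s.2.1.length * (bits J + bits Ms + 1 + 1) ≤ bits J * (bits J + bits Ms + 2) :=
    Nat.mul_le_mul_right _ (by have := length_lt_bits J; omega)
  have h7 := bits_le_of_sublist h1
  have h8 : bits s.2.2 ≤ bits J :=
    (bits_mono (by omega : s.2.2 ≤ Stage.volume (J, [], 0))).trans (bits_volume_le _)
  rw [bits_prod, bits_prod]
  omega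

theorem bits_partials_le {J : List Job} {Ms : List (ℕ × ℕ)} {l : List Partial} {N : ℕ}
    (h : ∀ s ∈ l, Stage.IsPartial J Ms s) (hl : l.length ≤ N) :
    bits l ≤ N * (bits J + (bits J * (bits J + bits Ms + 2) + 1) + bits J + 3) + 1 :=
  (bits_list_le fun s hs => (h s hs).bits_le).trans
    (Nat.add_le_add_right (Nat.mul_le_mul_right _ hl) 1)

theorem comp_search : Comp (fun e => bits e + searchWidth e) search := by
  have hw : PolyBdd (fun e => bits e + searchWidth e) searchWidth :=
    PolyBdd.self.mono fun e => Nat.le_add_left _ _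
  have hb : PolyBdd (fun e => bits e + searchWidth e) bits :=
    PolyBdd.self.mono fun e => Nat.le_add_right _ _
  have h := Comp.mono Comp.id hb
  have hJ := h.fst.snd.snd.bits_output
  have hM := h.snd.bits_output
  refine comp_search_of_bits_le hb ((hw.mul (((hJ.add ((hJ.mul ((hJ.add hM).add (.const 2))).add
    (.const 1))).add hJ).add (.const 3))).add (.const 1)) (fun e l M hl t _ => ?_) (fun e l hl => ?_)
  · have hM : M ∈ e.2 := hl.subset (by simp)
    obtain ⟨h1, h2⟩ := search_bounds e ((List.prefix_append _ _).trans hl)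
    exact bits_partials_le (Stage.isPartial_largeState (p := (e.1, M)) hM h2 t)
      (Stage.length_largeState_le (fun s hs => (h2 s hs).1) h1 (keyBound_le_searchWidth hM) t)
  · obtain ⟨h1, h2⟩ := search_bounds e hl
    exact bits_partials_le h2 h1

/-! ### Soundness: what a partial schedule found by the search guarantees. -/

/-- The sum of `f` over the jobs that are assigned to machine `i`. -/
def assignedSum (f : Job → ℕ) (A : List (Job × ℕ)) (i : ℕ) : ℕ :=
  ((A.filter fun y => decide (y.2 = i)).map fun y => f y.1).sum

theorem assignedSum_cons (f : Job → ℕ) (x : Job) (k : ℕ) (A : List (Job × ℕ)) (i : ℕ) :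
    assignedSum f ((x, k) :: A) i = (if k = i then f x else 0) + assignedSum f A i := by
  by_cases h : k = i <;> simp [assignedSum, h]

theorem assignedSum_eq_zero {f : Job → ℕ} {A : List (Job × ℕ)} {i : ℕ} (h : ∀ y ∈ A, y.2 ≠ i) :
    assignedSum f A i = 0 := by
  have : A.filter (fun y => decide (y.2 = i)) = [] := by simpa [List.filter_eq_nil_iff] using h
  simp [assignedSum, this]

/-- Since job indices are distinct, the filter in `place` removes exactly the job that is assigned.
-/
theorem List.cons_filter_ne_perm {α β : Type*} [DecidableEq β] (f : α → β) {l : List α} {x : α}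
    (hl : (l.map f).Nodup) (hx : x ∈ l) : (x :: l.filter fun y => decide (¬ f y = f x)).Perm l := by
  induction l with
  | nil => simp at hx
  | cons y l ih =>
    rw [List.map_cons, List.nodup_cons] at hl
    rcases List.mem_cons.1 hx with rfl | hx
    · have : l.filter (fun y => decide (¬ f y = f x)) = l := by
        rw [List.filter_eq_self]
        intro y hy
        exact decide_eq_true fun h => hl.1 (h ▸ List.mem_map_of_mem hy)
      rw [List.filter_cons_of_neg (by simp), this]
    · have hne : ¬ f y = f x := fun h => hl.1 (h ▸ List.mem_map_of_mem hx)
      rw [List.filter_cons_of_pos (by simpa using hne)]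
      exact (List.Perm.swap _ _ _).trans ((ih hl.2 hx).cons _)

/-- A sound partial schedule for the machines in `Ms`: the jobs fit, and no machine exceeds the
makespan by more than the fraction `1 / q`. -/
def IsSound (e : ℕ × ℕ × List Job) (Ms : List (ℕ × ℕ)) (s : Partial) : Prop :=
  (s.2.1.map (fun y => y.1) ++ s.1).Perm e.2.2 ∧
  (∀ y ∈ s.2.1, ∃ M ∈ Ms, y.2 = M.2 ∧ M.1 * y.1.1 ≤ e.2.1) ∧
  ∀ M ∈ Ms, e.1 * (M.1 * assignedSum (fun x => x.1) s.2.1 M.2) ≤ (e.1 + 1) * e.2.1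

namespace Stage

/-- Soundness at a stage, with the load of the machine under consideration. -/
def InStage (p : Stage) (Ms : List (ℕ × ℕ)) (s : Partial) : Prop :=
  IsSound p.1 (Ms ++ [p.2]) s ∧ assignedSum (fun x => x.1) s.2.1 p.machine = s.2.2

theorem InStage.assign {p : Stage} {Ms : List (ℕ × ℕ)} {s : Partial} (h : p.InStage Ms s)
    (hp : ∀ M ∈ Ms, M.2 ≠ p.machine) {x : Job} {U : List Job} (hU : (x :: U).Perm s.1)
    (hx : p.time * x.1 ≤ p.T) (hl : p.q * (p.time * (s.2.2 + x.1)) ≤ (p.q + 1) * p.T) :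
    p.InStage Ms (U, (x, p.machine) :: s.2.1, s.2.2 + x.1) := by
  obtain ⟨⟨h1, h2, h3⟩, h4⟩ := h
  have hm : assignedSum (fun x => x.1) ((x, p.machine) :: s.2.1) p.machine = s.2.2 + x.1 := by
    rw [assignedSum_cons, h4, if_pos rfl, add_comm]
  refine ⟨⟨?_, ?_, ?_⟩, hm⟩
  · exact (List.perm_middle.symm.trans (hU.append_left _)).trans h1
  · intro y hy
    rcases List.mem_cons.1 hy with rfl | hy
    · exact ⟨p.2, by simp, rfl, hx⟩
    · exact h2 y hy
  · intro M hM
    rcases List.mem_append.1 hM with hM' | hM'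
    · have := h3 M hM
      simpa only [assignedSum_cons, if_neg (hp M hM').symm, zero_add] using this
    · obtain rfl := List.mem_singleton.1 hM'
      exact hm ▸ hl

theorem InStage.place {p : Stage} {Ms : List (ℕ × ℕ)} {s : Partial} (h : p.InStage Ms s)
    (hp : ∀ M ∈ Ms, M.2 ≠ p.machine) (hJ : (p.jobs.map fun x => x.2.1).Nodup) {x : Job}
    (hx : x ∈ s.1) (hl : p.time * (s.2.2 + x.1) ≤ p.T) : p.InStage Ms (p.place s x) := by
  refine h.assign hp (List.cons_filter_ne_perm (fun y : Job => y.2.1) ?_ hx) ?_ ?_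
  · have := (h.1.1.map fun x => x.2.1).nodup_iff.2 hJ
    rw [List.map_append] at this
    exact this.of_append_right
  · exact (Nat.mul_le_mul_left _ (Nat.le_add_left _ _)).trans hl
  · exact Nat.mul_le_mul (Nat.le_succ _) hl

theorem InStage.fill {p : Stage} {Ms : List (ℕ × ℕ)} {s : Partial} (h : p.InStage Ms s)
    (hp : ∀ M ∈ Ms, M.2 ≠ p.machine) (hq : 0 < p.q) : p.InStage Ms (p.fill s) := by
  refine fill_induction h fun U₁ x U₂ A L hx hL h => ?_
  refine h.assign hp List.perm_middle.symm ((Nat.le_mul_of_pos_left _ hq).trans hx) ?_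
  change p.q * (p.time * (L + x.1)) ≤ (p.q + 1) * p.T
  -- The load before this job takes time at most `T`, and the job itself at most `T / q`.
  nlinarith

theorem inStage_largeState {p : Stage} {Ms : List (ℕ × ℕ)} {l : List Partial}
    (h : ∀ s ∈ l, IsSound p.1 Ms s) (hp : ∀ M ∈ Ms, M.2 ≠ p.machine)
    (hJ : (p.jobs.map fun x => x.2.1).Nodup) (t : ℕ) : ∀ s ∈ p.largeState l t, p.InStage Ms s := by
  induction t with
  | zero =>
    intro s hs
    obtain ⟨s', hs', rfl⟩ := List.mem_map.1 hs
    obtain ⟨h1, h2, h3⟩ := h s' hs'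
    have h0 : assignedSum (fun x => x.1) s'.2.1 p.machine = 0 := assignedSum_eq_zero fun y hy => by
      obtain ⟨M, hM, hy, -⟩ := h2 y hy
      exact hy ▸ hp M hM
    refine ⟨⟨h1, fun y hy => ?_, fun M hM => ?_⟩, h0⟩
    · obtain ⟨M, hM, h⟩ := h2 y hy
      exact ⟨M, List.mem_append_left _ hM, h⟩
    · rcases List.mem_append.1 hM with hM | hM
      · exact h3 M hM
      · obtain rfl := List.mem_singleton.1 hM
        change p.q * (p.time * assignedSum (fun x => x.1) s'.2.1 p.machine) ≤ _
        simp [h0]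
  | succ t ih =>
    intro s hs
    rw [largeState, Function.iterate_succ_apply'] at hs
    obtain ⟨s', hs', rfl | ⟨x, hx, -, hl, rfl⟩⟩ := mem_expand hs
    · exact ih _ hs'
    · exact (ih _ hs').place hp hJ hx hl

theorem isSound_step {p : Stage} {Ms : List (ℕ × ℕ)} {l : List Partial}
    (h : ∀ s ∈ l, IsSound p.1 Ms s) (hp : ∀ M ∈ Ms, M.2 ≠ p.machine)
    (hJ : (p.jobs.map fun x => x.2.1).Nodup) (hq : 0 < p.q) :
    ∀ s ∈ p.step l, IsSound p.1 (Ms ++ [p.2]) s := by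
  intro s hs
  rw [step_eq] at hs
  obtain ⟨s', hs', rfl⟩ := List.mem_map.1 hs
  exact ((inStage_largeState h hp hJ _ s' hs').fill hp hq).1

/-! ### Completeness: domination of a given schedule. -/

/-- The loads of the jobs that are not assigned. -/
def rest (s : Partial) : Multiset ℕ := ↑(s.1.map fun x => x.1)

theorem volume_eq (s : Partial) : volume s = (rest s).sum := by simp [volume, rest]

theorem count_rest (s : Partial) (r : ℕ) :
    (rest s).count r = (s.1.filter fun y => decide (y.1 = r)).length := by
  rw [rest, Multiset.coe_count, List.count, List.countP_map, List.countP_eq_length_filter]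
  rfl

/-- `s` is at least as good as a partial schedule in which jobs with loads `W` are left, in view of
machines with processing time at most `b`. -/
def Dominates (e : ℕ × ℕ × List Job) (b : ℕ) (W : Multiset ℕ) (s : Partial) : Prop :=
  (∀ r, e.2.1 < e.1 * (b * r) → (rest s).count r = W.count r) ∧ (rest s).sum ≤ W.sum

/-- Merging is harmless. For a load that fits on the current machine the key records the count, and
for a load of no job both counts vanish. For a load too big for this machine both counts are those
of the full job list, since the earlier machines are no faster. -/
theorem Dominates.of_key_eq {p : Stage} {Ms : List (ℕ × ℕ)} {W : Multiset ℕ} {s s' : Partial}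
    (h : Dominates p.1 p.time W s) (hs : p.InStage Ms s) (hs' : p.InStage Ms s')
    (hMs : ∀ M ∈ Ms, p.time ≤ M.1) (hk : p.key s' = p.key s) (hv : volume s' ≤ volume s) :
    Dominates p.1 p.time W s' := by
  refine ⟨fun r hr => (?_ : _ = _).trans (h.1 r hr), ?_⟩
  · by_cases hT : p.time * r ≤ p.T
    · by_cases hJ : ∃ x ∈ p.jobs, x.1 = r
      · obtain ⟨x, hx, rfl⟩ := hJ
        have := List.map_inj_left.1 (congrArg Prod.fst hk) x hx
        rw [if_pos ⟨hr, hT⟩, if_pos ⟨hr, hT⟩] at this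
        rw [count_rest, count_rest, this]
      · have h0 : ∀ s, p.InStage Ms s → (rest s).count r = 0 := by
          intro s hs
          rw [Multiset.count_eq_zero, rest, Multiset.mem_coe, List.mem_map]
          rintro ⟨x, hx, rfl⟩
          exact hJ ⟨x, hs.1.1.subset (List.mem_append_right _ hx), rfl⟩
        rw [h0 s hs, h0 s' hs']
    -- An assigned job of load `r` would fit on its machine, whose time is at least that of the
    -- current one, so `r` would fit here too.
    · have h0 : ∀ s, p.InStage Ms s →
          (rest s).count r = (p.jobs.map fun x => x.1).count r := by
        intro s hs
        rw [← (hs.1.1.map fun x => x.1).count_eq, List.map_append, List.count_append, rest,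
          Multiset.coe_count, right_eq_add, List.count_eq_zero]
        intro hr
        obtain ⟨x, hx, rfl⟩ := List.mem_map.1 hr
        obtain ⟨y, hy, rfl⟩ := List.mem_map.1 hx
        obtain ⟨M, hM, -, hy⟩ := hs.1.2.1 y hy
        refine hT ((Nat.mul_le_mul_right _ ?_).trans hy)
        rcases List.mem_append.1 hM with hM | hM
        · exact hMs M hM
        · rw [List.mem_singleton.1 hM]
      rw [h0 s hs, h0 s' hs']
  · rw [volume_eq, volume_eq] at hv
    exact hv.trans h.2

theorem exists_key_eq_insert {p : Stage} {l : List Partial} {s₀ : Partial}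
    (h : ∃ s' ∈ l, p.key s' = p.key s₀ ∧ volume s' ≤ volume s₀) (s : Partial) :
    ∃ s' ∈ p.insert l s, p.key s' = p.key s₀ ∧ volume s' ≤ volume s₀ := by
  obtain ⟨s', hs', hk, hv⟩ := h
  unfold insert
  split
  · exact ⟨s', hs', hk, hv⟩
  · rename_i hany
    by_cases he : p.key s' = p.key s
    · refine ⟨s, List.mem_cons_self, he ▸ hk, ?_⟩
      -- If the discarded `s'` had at most the volume of `s`, then the test would have rejected `s`
      -- instead.
      by_contra hlt
      refine hany (List.any_eq_true.2 ⟨s', hs', decide_eq_true ⟨by rw [he]; exact ⟨rfl, rfl⟩, ?_⟩⟩)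
      omega
    · refine ⟨s', List.mem_cons_of_mem _ (List.mem_filter.2 ⟨hs', decide_eq_true ?_⟩), hk, hv⟩
      exact fun h => he (Prod.ext h.1 h.2)

theorem exists_key_eq_insert_self (p : Stage) (l : List Partial) (s : Partial) :
    ∃ s' ∈ p.insert l s, p.key s' = p.key s ∧ volume s' ≤ volume s := by
  unfold insert
  split
  · rename_i hany
    obtain ⟨s', hs', h⟩ := List.any_eq_true.1 hany
    have := of_decide_eq_true h
    exact ⟨s', hs', Prod.ext this.1.1 this.1.2, this.2⟩
  · exact ⟨s, List.mem_cons_self, rfl, le_rfl⟩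

theorem exists_key_eq_expand {p : Stage} {l : List Partial} {s : Partial}
    (h : s ∈ l.flatMap p.candidates) :
    ∃ s' ∈ p.expand l, p.key s' = p.key s ∧ volume s' ≤ volume s := by
  have hkeep : ∀ (l' l : List Partial), (∃ s' ∈ l, p.key s' = p.key s ∧ volume s' ≤ volume s) →
      ∃ s' ∈ l'.foldl p.insert l, p.key s' = p.key s ∧ volume s' ≤ volume s := by
    intro l'
    induction l' with
    | nil => exact fun _ h => h
    | cons x l' ih => exact fun l h => ih _ (exists_key_eq_insert h x)
  obtain ⟨l₁, l₂, hl⟩ := List.append_of_mem h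
  rw [expand, hl, List.foldl_append, List.foldl_cons]
  exact hkeep _ _ (exists_key_eq_insert_self _ _ _)

end Stage

namespace Stage

theorem Dominates.place {p : Stage} {Ms : List (ℕ × ℕ)} {W : Multiset ℕ} {s : Partial}
    (hs : p.InStage Ms s) (hJ : (p.jobs.map fun x => x.2.1).Nodup) {x : Job} (hx : x ∈ s.1)
    (h : Dominates p.1 p.time (x.1 ::ₘ W) s) : Dominates p.1 p.time W (p.place s x) := by
  have hnd : (s.1.map fun x => x.2.1).Nodup := by
    have := (hs.1.1.map fun x => x.2.1).nodup_iff.2 hJ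
    rw [List.map_append] at this
    exact this.of_append_right
  have hr : rest s = x.1 ::ₘ rest (p.place s x) := by
    have := (List.cons_filter_ne_perm (fun y : Job => y.2.1) hnd hx).map fun x => x.1
    rw [rest, ← Multiset.coe_eq_coe.2 this]
    rfl
  obtain ⟨h1, h2⟩ := h
  rw [hr] at h1 h2
  refine ⟨fun r hr => ?_, ?_⟩
  · have := h1 r hr
    rw [Multiset.count_cons, Multiset.count_cons] at this
    omega
  · rw [Multiset.sum_cons, Multiset.sum_cons] at h2
    omega

/-- `O` consists of the large loads that the reference schedule puts on this machine, one of which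
is placed per round; if `O` is exhausted early, the candidate that places nothing is taken. The
candidate may be merged into another partial schedule with the same key, which inherits domination
by `of_key_eq` and the machine load from the key. -/
theorem exists_dominates_largeState {p : Stage} {Ms : List (ℕ × ℕ)} {l : List Partial}
    (h : ∀ s ∈ l, IsSound p.1 Ms s) (hp : ∀ M ∈ Ms, M.2 ≠ p.machine) (hMs : ∀ M ∈ Ms, p.time ≤ M.1)
    (hJ : (p.jobs.map fun x => x.2.1).Nodup) {s₀ : Partial} (hs₀ : s₀ ∈ l) (t : ℕ) (O W : Multiset ℕ)
    (ht : O.card ≤ t) (hO : ∀ r ∈ O, p.IsLarge r) (hT : p.time * O.sum ≤ p.T)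
    (hD : Dominates p.1 p.time (O + W) s₀) :
    ∃ s ∈ p.largeState l t, Dominates p.1 p.time W s ∧ s.2.2 = O.sum := by
  have hin := inStage_largeState h hp hJ
  induction t generalizing O W with
  | zero =>
    obtain rfl := Multiset.card_eq_zero.1 (Nat.le_zero.1 ht)
    exact ⟨_, List.mem_map_of_mem hs₀, by simpa [Dominates, rest] using hD, rfl⟩
  | succ t ih =>
    have hin' := hin (t + 1)
    have hstep : p.largeState l (t + 1) = p.expand (p.largeState l t) := by
      rw [largeState, Function.iterate_succ_apply']
      rfl
    suffices hs : ∃ s ∈ (p.largeState l t).flatMap p.candidates, p.InStage Ms s ∧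
        Dominates p.1 p.time W s ∧ s.2.2 = O.sum by
      obtain ⟨s, hs, hsin, hsD, hsO⟩ := hs
      obtain ⟨s', hs', hk, hv⟩ := exists_key_eq_expand hs
      rw [← hstep] at hs'
      exact ⟨s', hs', hsD.of_key_eq hsin (hin' s' hs') hMs hk hv, (congrArg Prod.snd hk).trans hsO⟩
    induction O using Multiset.induction_on with
    | empty =>
      obtain ⟨s, hs, hsD, hsO⟩ := ih 0 W (by simp) (by simp) (by simp) hD
      exact ⟨s, List.mem_flatMap.2 ⟨s, hs, List.mem_cons_self⟩, hin t s hs, hsD, hsO⟩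
    | cons r O _ =>
      rw [Multiset.sum_cons] at hT
      obtain ⟨s, hs, hsD, hsO⟩ := ih O (r ::ₘ W) (by simpa using ht)
        (fun x hx => hO x (Multiset.mem_cons_of_mem hx))
        ((Nat.mul_le_mul_left _ (Nat.le_add_left _ _)).trans hT)
        (by rwa [Multiset.add_cons, ← Multiset.cons_add])
      have hr := hO r (Multiset.mem_cons_self r O)
      -- Counts agree exactly for loads that are not small, so a job of load `r` is still available.
      have hmem : r ∈ rest s := by
        rw [← Multiset.count_pos, hsD.1 r hr.1]
        simp
      obtain ⟨x, hx, rfl⟩ := List.mem_map.1 (Multiset.mem_coe.1 hmem)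
      have hl : p.time * (s.2.2 + x.1) ≤ p.T := by rwa [hsO, add_comm]
      refine ⟨p.place s x, List.mem_flatMap.2 ⟨s, hs, List.mem_cons_of_mem _ (List.mem_map_of_mem
        (List.mem_filter.2 ⟨hx, decide_eq_true ⟨hr, hl⟩⟩))⟩, (hin t s hs).place hp hJ hx hl,
        hsD.place (hin t s hs) hJ hx, ?_⟩
      simp [Stage.place, hsO, add_comm]

theorem exists_rest_fill (p : Stage) (s : Partial) : ∃ P : Multiset ℕ,
    (∀ r ∈ P, p.q * (p.time * r) ≤ p.T) ∧ rest s = P + rest (p.fill s) ∧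
      (p.fill s).2.2 = s.2.2 + P.sum := by
  refine fill_induction (C := fun s' => ∃ P : Multiset ℕ, (∀ r ∈ P, p.q * (p.time * r) ≤ p.T) ∧
    rest s = P + rest s' ∧ s'.2.2 = s.2.2 + P.sum) ⟨0, by simp⟩ ?_
  rintro U₁ x U₂ A L hx - ⟨P, h1, h2, h3⟩
  refine ⟨x.1 ::ₘ P, by simpa using ⟨hx, h1⟩, ?_, ?_⟩
  · rw [h2]
    simp only [rest, List.map_append, List.map_cons, ← Multiset.coe_add, ← Multiset.cons_coe,
      Multiset.add_cons, Multiset.cons_add]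
  · simp only [Multiset.sum_cons] at h3 ⊢
    omega

/-- A small job is put aside only if the machine is full, and a full machine stays full because its
load never decreases. -/
theorem full_or_large_of_mem_fill (p : Stage) (s : Partial) :
    p.T < p.time * (p.fill s).2.2 ∨ ∀ x ∈ (p.fill s).1, p.T < p.q * (p.time * x.1) := by
  have hmono : ∀ (l : List Job) k, k.2.2 ≤ (l.foldl p.pour k).2.2 := by
    intro l
    induction l with
    | nil => exact fun k => le_rfl
    | cons x l ih =>
      refine fun k => le_trans ?_ (ih _)
      unfold pour
      split
      · exact Nat.le_add_right _ _
      · exact le_rfl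
  suffices h : ∀ (l : List Job) k, (∀ x ∈ k.1, p.T < p.q * (p.time * x.1)) →
      (p.T < p.time * (l.foldl p.pour k).2.2 ∨
        ∀ x ∈ (l.foldl p.pour k).1, p.T < p.q * (p.time * x.1)) by
    simpa [fill] using h s.1 ([], s.2) (by simp)
  intro l
  induction l with
  | nil => exact fun k hk => .inr hk
  | cons x l ih =>
    intro k hk
    rw [List.foldl_cons]
    by_cases hfull : p.T < p.time * k.2.2
    · refine .inl (hfull.trans_le (Nat.mul_le_mul_left _ ((?_ : _ ≤ _).trans (hmono l _))))
      exact hmono [x] k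
    · refine ih _ ?_
      unfold pour
      split
      · exact hk
      · rename_i hx
        intro y hy
        rcases List.mem_cons.1 hy with rfl | hy
        · by_contra hy
          exact hx ⟨not_lt.1 hy, not_lt.1 hfull⟩
        · exact hk y hy

/-- If the machine ends up full, then more volume has been poured than the reference schedule's `S`,
so no more than `W.sum` is left. Otherwise no small job is left; the other counts agree with `W`, so
the remaining loads form a sub-multiset of `W`. -/
theorem Dominates.fill {p : Stage} {S W : Multiset ℕ} {s : Partial}
    (h : Dominates p.1 p.time (S + W) s) (hS : ∀ r ∈ S, p.q * (p.time * r) ≤ p.T)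
    (hT : p.time * (s.2.2 + S.sum) ≤ p.T) : Dominates p.1 p.time W (p.fill s) := by
  obtain ⟨P, hP, hr, hL⟩ := exists_rest_fill p s
  obtain ⟨h1, h2⟩ := h
  have hzero : ∀ {X : Multiset ℕ} {r}, (∀ r ∈ X, p.q * (p.time * r) ≤ p.T) →
      p.T < p.q * (p.time * r) → X.count r = 0 := fun hX hr =>
    Multiset.count_eq_zero.2 fun hm => (hX _ hm).not_gt hr
  have hcount : ∀ r, p.T < p.q * (p.time * r) → (rest (p.fill s)).count r = W.count r := by
    intro r hlarge
    have := h1 r hlarge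
    rwa [hr, Multiset.count_add, Multiset.count_add, hzero hP hlarge, hzero hS hlarge, zero_add,
      zero_add] at this
  refine ⟨hcount, ?_⟩
  rcases full_or_large_of_mem_fill p s with hfull | hlarge
  · rw [hr, Multiset.sum_add, Multiset.sum_add] at h2
    rw [hL] at hfull
    have := lt_of_mul_lt_mul_left (hT.trans_lt hfull) (Nat.zero_le _)
    omega
  · have hle : rest (p.fill s) ≤ W := Multiset.le_iff_count.2 fun r => by
      by_cases hm : r ∈ rest (p.fill s)
      · obtain ⟨x, hx, rfl⟩ := List.mem_map.1 (Multiset.mem_coe.1 hm)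
        exact (hcount _ (hlarge x hx)).le
      · rw [Multiset.count_eq_zero.2 hm]
        exact Nat.zero_le _
    obtain ⟨Z, rfl⟩ := Multiset.le_iff_exists_add.1 hle
    simp

theorem exists_dominates_step {p : Stage} {Ms : List (ℕ × ℕ)} {l : List Partial}
    (h : ∀ s ∈ l, IsSound p.1 Ms s) (hp : ∀ M ∈ Ms, M.2 ≠ p.machine) (hMs : ∀ M ∈ Ms, p.time ≤ M.1)
    (hJ : (p.jobs.map fun x => x.2.1).Nodup) {s₀ : Partial} (hs₀ : s₀ ∈ l) (O W : Multiset ℕ)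
    (hT : p.time * O.sum ≤ p.T) (hD : Dominates p.1 p.time (O + W) s₀) :
    ∃ s ∈ p.step l, Dominates p.1 p.time W s := by
  let c : ℕ → Prop := fun r => p.T < p.q * (p.time * r)
  have hO := Multiset.filter_add_not c O
  have hfit : ∀ r ∈ O, p.time * r ≤ p.T := fun r hr =>
    (Nat.mul_le_mul_left _ (Multiset.le_sum_of_mem hr)).trans hT
  have hsum : (O.filter c).sum + (O.filter fun r => ¬ c r).sum = O.sum := by
    rw [← Multiset.sum_add, hO]
  -- The large loads in `O` are among those left in `s₀`, so one round per job is enough.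
  have hcard : (O.filter c).card ≤ p.jobs.length := by
    refine (Multiset.card_le_card (Multiset.le_iff_count.2 fun r => ?_ : _ ≤ rest s₀)).trans ?_
    · by_cases hr : c r
      · rw [Multiset.count_filter_of_pos hr, hD.1 r hr, Multiset.count_add]
        exact Nat.le_add_right _ _
      · rw [Multiset.count_filter_of_neg hr]
        exact Nat.zero_le _
    · have := (h s₀ hs₀).1.length_eq
      simp only [List.length_append] at this
      simp only [rest, Multiset.coe_card, List.length_map]
      change _ = p.jobs.length at this
      omega
  obtain ⟨s, hs, hsD, hsO⟩ := exists_dominates_largeState h hp hMs hJ hs₀ p.jobs.length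
    (O.filter c) ((O.filter fun r => ¬ c r) + W) hcard
    (fun r hr => ⟨(Multiset.mem_filter.1 hr).2, hfit r (Multiset.mem_filter.1 hr).1⟩)
    ((Nat.mul_le_mul_left _ (hsum ▸ Nat.le_add_right _ _)).trans hT) (by rwa [← add_assoc, hO])
  rw [step_eq]
  exact ⟨_, List.mem_map_of_mem hs, hsD.fill (fun r hr => not_lt.1 (Multiset.mem_filter.1 hr).2)
    (by rwa [hsO, hsum])⟩

end Stage

/-- The machines are sorted, slow ones first, and have different indices. -/
def SortedMachines (Ms : List (ℕ × ℕ)) : Prop :=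
  Ms.Pairwise fun M M' => M'.1 ≤ M.1 ∧ M.2 ≠ M'.2

theorem isSound_search {e : ℕ × ℕ × List Job} {Ms : List (ℕ × ℕ)} (hMs : SortedMachines Ms)
    (hJ : (e.2.2.map fun x => x.2.1).Nodup) (hq : 0 < e.1) :
    ∀ s ∈ search (e, Ms), IsSound e Ms s := by
  induction Ms using List.reverseRecOn with
  | nil =>
    intro s hs
    obtain rfl := List.mem_singleton.1 hs
    exact ⟨by simp, by simp, by simp⟩
  | append_singleton Ms M ih =>
    obtain ⟨h1, -, h2⟩ := List.pairwise_append.1 hMs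
    rw [search_append]
    exact Stage.isSound_step (p := (e, M)) (ih h1) (fun M' hM' => (h2 M' hM' M (by simp)).2) hJ hq

/-- `O` lists the loads on each machine in a schedule of makespan at most `T`. That schedule is
followed machine by machine; domination at the end leaves no volume, and loads are positive. -/
theorem exists_mem_search {e : ℕ × ℕ × List Job} {Ms : List (ℕ × ℕ)} (hMs : SortedMachines Ms)
    (hJ : (e.2.2.map fun x => x.2.1).Nodup) (hq : 0 < e.1) (hpos : ∀ x ∈ e.2.2, 0 < x.1)
    (O : ℕ × ℕ → Multiset ℕ) (hO : (Ms.map O).sum = ↑(e.2.2.map fun x => x.1))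
    (hT : ∀ M ∈ Ms, M.1 * (O M).sum ≤ e.2.1) : ∃ s ∈ search (e, Ms), s.1 = [] := by
  -- All `b` up to the times of the treated machines are allowed: the next machine needs its own
  -- time, and the end of the argument needs `b = 0`.
  have key : ∀ l l', Ms = l ++ l' → ∃ s ∈ search (e, l), ∀ b, (∀ M ∈ l, b ≤ M.1) →
      Stage.Dominates e b (l'.map O).sum s := by
    intro l
    induction l using List.reverseRecOn with
    | nil =>
      rintro l' rfl
      refine ⟨_, List.mem_singleton_self _, fun b _ => ?_⟩
      rw [hO]
      exact ⟨fun r _ => rfl, le_rfl⟩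
    | append_singleton l M ih =>
      intro l' hl
      rw [List.append_assoc] at hl
      obtain ⟨s, hs, hsD⟩ := ih _ hl
      subst hl
      obtain ⟨h1, h2, h3⟩ := List.pairwise_append.1 hMs
      have hM := fun M' hM' => h3 M' hM' M (by simp)
      obtain ⟨s', hs', h⟩ := Stage.exists_dominates_step (p := (e, M)) (isSound_search h1 hJ hq)
        (fun M' hM' => (hM M' hM').2) (fun M' hM' => (hM M' hM').1) hJ hs (O M) (l'.map O).sum
        (hT M (by simp)) (by simpa using hsD M.1 fun M' hM' => (hM M' hM').1)
      refine ⟨s', by rwa [search_append], fun b hb => ⟨fun r hr => h.1 r (hr.trans_le ?_), h.2⟩⟩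
      exact Nat.mul_le_mul_left _ (Nat.mul_le_mul_right _ (hb M (by simp)))
  obtain ⟨s, hs, h⟩ := key Ms [] (by simp)
  refine ⟨s, hs, List.eq_nil_iff_forall_not_mem.2 fun x hx => ?_⟩
  -- For `b = 0` the condition on counts is void; the volume is at most that of the empty list of
  -- remaining machines, which is 0.
  have h1 := (h 0 (by simp)).2
  have h2 : x.1 ≤ (Stage.rest s).sum := Multiset.le_sum_of_mem (List.mem_map_of_mem hx)
  have h3 := hpos x ((isSound_search hMs hJ hq s hs).1.subset (List.mem_append_right _ hx))
  simp at h1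
  omega

/-! ## Rounding and sorting -/

/-- The largest power of two `e` with `e * q ≤ w`, or `1` if there is none. -/
def roundUnit (q w : ℕ) : ℕ :=
  (twoPowers w).foldl (fun e p => if p * q ≤ w ∧ e < p then p else e) 1

/-- `w`, rounded up to a multiple of `roundUnit q w`. -/
def roundUp (q w : ℕ) : ℕ := roundUnit q w * ((w + roundUnit q w - 1) / roundUnit q w)

/-- The fold finds the largest power of two that passes the test, so its double fails: this is the
last claim. -/
theorem roundUnit_spec (q w : ℕ) : (∃ k, roundUnit q w = 2 ^ k) ∧
    (roundUnit q w = 1 ∨ roundUnit q w * q ≤ w) ∧ (0 < q → w < 2 * roundUnit q w * q) := by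
  have key : ∀ (l : List ℕ) e, (∀ p ∈ l, ∃ k, p = 2 ^ k) → (∃ k, e = 2 ^ k) → (e = 1 ∨ e * q ≤ w) →
      let u := l.foldl (fun e p => if p * q ≤ w ∧ e < p then p else e) e
      (∃ k, u = 2 ^ k) ∧ (u = 1 ∨ u * q ≤ w) ∧ e ≤ u ∧ ∀ p ∈ l, p * q ≤ w → p ≤ u := by
    intro l
    induction l with
    | nil => exact fun e _ h1 h2 => ⟨h1, h2, le_rfl, by simp⟩
    | cons p l ih =>
      intro e hl h1 h2
      rw [List.foldl_cons]
      have hl' := fun p hp => hl p (List.mem_cons_of_mem _ hp)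
      split
      · rename_i hp
        obtain ⟨h1, h2, h3, h4⟩ := ih p hl' (hl p List.mem_cons_self) (.inr hp.1)
        refine ⟨h1, h2, hp.2.le.trans h3, fun x hx hxw => ?_⟩
        rcases List.mem_cons.1 hx with rfl | hx
        · exact h3
        · exact h4 x hx hxw
      · rename_i hp
        obtain ⟨h1, h2, h3, h4⟩ := ih e hl' h1 h2
        refine ⟨h1, h2, h3, fun x hx hxw => ?_⟩
        rcases List.mem_cons.1 hx with rfl | hx
        · exact le_trans (by by_contra h; exact hp ⟨hxw, by omega⟩) h3
        · exact h4 x hx hxw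
  obtain ⟨⟨k, hk⟩, h2, -, h4⟩ := key (twoPowers w) 1 (fun p hp => (mem_twoPowers.1 hp).2) ⟨0, rfl⟩
    (.inl rfl)
  refine ⟨⟨k, hk⟩, h2, fun hq => ?_⟩
  by_contra! h
  have hle : 2 * roundUnit q w ≤ w := (Nat.le_mul_of_pos_right _ hq).trans h
  have hpos : 0 < roundUnit q w := by
    change 0 < List.foldl _ _ _
    rw [hk]; positivity
  have := h4 (2 * roundUnit q w) (mem_twoPowers.2 ⟨hle, k + 1, by
    rw [pow_succ, mul_comm]; exact congrArg (· * 2) hk⟩) h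
  change 2 * roundUnit q w ≤ roundUnit q w at this
  omega

theorem roundUnit_pos (q w : ℕ) : 0 < roundUnit q w := by
  obtain ⟨⟨k, hk⟩, -⟩ := roundUnit_spec q w
  rw [hk]; positivity

theorem le_roundUp (q w : ℕ) : w ≤ roundUp q w := by
  have h := roundUnit_pos q w
  have h1 := Nat.div_add_mod (w + roundUnit q w - 1) (roundUnit q w)
  have h2 := Nat.mod_lt (w + roundUnit q w - 1) h
  unfold roundUp
  omega

/-- With unit 1 nothing is rounded; otherwise rounding adds at most one unit, which is at most `w /
q`. -/
theorem mul_roundUp_le (q w : ℕ) : q * roundUp q w ≤ (q + 1) * w := by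
  obtain ⟨-, h, -⟩ := roundUnit_spec q w
  have h0 := roundUnit_pos q w
  have h1 := Nat.mul_div_le (w + roundUnit q w - 1) (roundUnit q w)
  rcases h with h | h
  · rw [roundUp, h] at *
    rw [Nat.div_one, one_mul, Nat.add_sub_cancel]
    exact Nat.mul_le_mul_right _ (Nat.le_succ _)
  · have : roundUp q w ≤ w + roundUnit q w := by unfold roundUp; omega
    nlinarith

/-- The unit `u` satisfies `w < 2 * u * q`, so at most `2 * q` units are needed. Rounded loads of
similar magnitude therefore take few values. -/
theorem exists_roundUp_eq {q : ℕ} (hq : 0 < q) (w : ℕ) : ∃ k a, a ≤ 2 * q ∧ roundUp q w = 2 ^ k * a := by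
  obtain ⟨⟨k, hk⟩, -, h⟩ := roundUnit_spec q w
  refine ⟨k, (w + roundUnit q w - 1) / roundUnit q w, ?_, by rw [← hk]; rfl⟩
  have h0 := roundUnit_pos q w
  have := h hq
  rw [← Nat.lt_succ_iff, Nat.div_lt_iff_lt_mul h0]
  have : (2 * q).succ * roundUnit q w = 2 * roundUnit q w * q + roundUnit q w := by
    rw [Nat.succ_eq_add_one]; ring
  omega

theorem pt_roundUp : PT fun a : ℕ × ℕ => roundUp a.1 a.2 := by
  have h := Comp.id (α := ℕ × ℕ)
  have h' := Comp.id (α := (ℕ × ℕ) × ℕ × ℕ)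
  have hu : Comp bits fun a : ℕ × ℕ => roundUnit a.1 a.2 := by
    refine Comp.foldl_of_bits_add (T := .X)
      (step := fun (a : ℕ × ℕ) e p => if p * a.1 ≤ a.2 ∧ e < p then p else e)
      (.ite (((h'.snd.snd.mul h'.fst.fst).le h'.fst.snd).and (h'.snd.fst.lt h'.snd.snd))
        h'.snd.snd h'.snd.fst) (PT.twoPowers.comp h.snd) (.const h.bits_input 1) fun a s x => ?_
    simp only [Polynomial.eval_X]
    split <;> omega
  exact hu.mul (((h.snd.add hu).sub (.const h.bits_input 1)).div hu)

/-- Insert a machine into a list of machines that is sorted, slow ones first. -/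
def insertMachine (l : List (ℕ × ℕ)) (M : ℕ × ℕ) : List (ℕ × ℕ) :=
  l.filter (fun M' => decide (M.1 ≤ M'.1)) ++ M :: l.filter fun M' => decide (¬ M.1 ≤ M'.1)

def sortMachines (l : List (ℕ × ℕ)) : List (ℕ × ℕ) := l.foldl insertMachine []

theorem insertMachine_perm (l : List (ℕ × ℕ)) (M : ℕ × ℕ) : (insertMachine l M).Perm (M :: l) := by
  refine List.perm_middle.trans (List.Perm.cons _ ?_)
  have := List.filter_append_perm (fun M' : ℕ × ℕ => decide (M.1 ≤ M'.1)) l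
  simpa only [decide_not] using this

theorem pairwise_insertMachine {l : List (ℕ × ℕ)} (h : l.Pairwise fun M M' => M'.1 ≤ M.1) (M : ℕ × ℕ) :
    (insertMachine l M).Pairwise fun M M' => M'.1 ≤ M.1 := by
  refine List.pairwise_append.2 ⟨h.sublist List.filter_sublist, List.pairwise_cons.2 ⟨?_,
    h.sublist List.filter_sublist⟩, ?_⟩
  · intro M' hM'
    have := of_decide_eq_true (List.mem_filter.1 hM').2
    omega
  · intro M₁ h₁ M₂ h₂
    have h₁ := of_decide_eq_true (List.mem_filter.1 h₁).2
    rcases List.mem_cons.1 h₂ with rfl | h₂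
    · exact h₁
    · have h₂ := of_decide_eq_true (List.mem_filter.1 h₂).2
      omega

theorem sortMachines_perm (l : List (ℕ × ℕ)) : (sortMachines l).Perm l := by
  suffices h : ∀ l l' : List (ℕ × ℕ), (l.foldl insertMachine l').Perm (l' ++ l) from h l []
  intro l
  induction l with
  | nil => simp
  | cons M l ih =>
    exact fun l' => (ih _).trans (((insertMachine_perm l' M).append_right l).trans
      List.perm_middle.symm)

theorem pairwise_sortMachines (l : List (ℕ × ℕ)) :
    (sortMachines l).Pairwise fun M M' => M'.1 ≤ M.1 := by
  suffices h : ∀ l l' : List (ℕ × ℕ), (l'.Pairwise fun M M' => M'.1 ≤ M.1) →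
    (l.foldl insertMachine l').Pairwise fun M M' => M'.1 ≤ M.1 from h l [] .nil
  intro l
  induction l with
  | nil => exact fun _ h => h
  | cons M l ih => exact fun l' h => ih _ (pairwise_insertMachine h M)

theorem pt_sortMachines : PT sortMachines := by
  have h' := Comp.id (α := List (ℕ × ℕ) × List (ℕ × ℕ) × ℕ × ℕ)
  have h'' := Comp.id (α := (List (ℕ × ℕ) × List (ℕ × ℕ) × ℕ × ℕ) × ℕ × ℕ)
  have hc := h''.fst.snd.snd.fst.le h''.snd.fst
  refine Comp.foldl_of_bits_add (T := .X + 1) (step := fun _ => insertMachine)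
    ((h'.snd.fst.filter hc).append (h'.snd.snd.cons (h'.snd.fst.filter hc.not)))
    Comp.id (.const Comp.id.bits_input []) fun a l M => ?_
  have hT : Polynomial.eval (bits a + bits M) (.X + 1 : Polynomial ℕ) = bits a + bits M + 1 := by simp
  have : bits (insertMachine l M) = bits (M :: l) := by
    rw [bits_list, bits_list, ((insertMachine_perm l M).map _).sum_eq]
  rw [this, bits_cons, hT]
  omega

/-! ## The scheduling algorithm -/

/-- The accuracy `1 / q`, integral job loads and integral processing times. -/
abbrev Problem : Type := ℕ × List ℕ × List ℕ

namespace Problem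

def jobs (a : Problem) : List Job := a.2.1.zipIdx.map fun x => (roundUp a.1 x.1, x.2, x.1)

def machines (a : Problem) : List (ℕ × ℕ) := sortMachines a.2.2.zipIdx

/-- The assignments of all jobs that are found for the makespan `T`. -/
def solutions (a : Problem) (T : ℕ) : List Partial :=
  (search ((a.1, T, a.jobs), a.machines)).filter fun s => decide (s.1 = [])

/-- An upper bound for the makespan with rounded loads. -/
def upperBound (a : Problem) : ℕ := (a.jobs.map fun x => x.1).sum * a.2.2.sum

/-- A makespan for which a schedule is found, by binary search. -/
def target (a : Problem) : ℕ :=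
  (twoPowers a.upperBound).foldl
    (fun T p => if a.solutions (T + p - 1) = [] then T + p else T) 0

/-- The jobs with their machines. -/
def assignment (a : Problem) : List (Job × ℕ) := (a.solutions a.target).foldl (fun _ s => s.2.1) []

end Problem

/-- The machine of the job with index `j`. -/
def machineOf (A : List (Job × ℕ)) (j : ℕ) : ℕ :=
  A.foldl (fun i y => if y.1.2.1 = j then y.2 else i) 0

namespace Problem

/-- The schedule and the payments, as fractions with denominator `D`. -/
def outcome (a : Problem) (D : ℕ) : List ℕ × List (ℕ × ℕ) :=
  (a.2.1.zipIdx.map fun x => machineOf a.assignment x.2,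
    a.2.2.zipIdx.map fun y => (y.1 * assignedSum (fun x => x.2.2) a.assignment y.2, D))

/-- A bound for the number of partial schedules in the dynamic program. -/
def width (a : Problem) : ℕ :=
  (a.2.1.length + 1) ^ (2 * min a.2.1.length ((2 * a.1 ^ 2 + 1) * (2 * a.1 + 1)))

/-! ### Running time of the algorithm for integral data. -/

theorem pt_jobs : PT jobs :=
  have h := Comp.id (α := Problem)
  have h' := Comp.id (α := Problem × ℕ × ℕ)
  h.snd.fst.zipIdx.map (Comp.prod (pt_roundUp.comp (h'.fst.fst.prod h'.snd.fst))
    (h'.snd.snd.prod h'.snd.fst))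

theorem pt_machines : PT machines :=
  have h := Comp.id (α := Problem)
  pt_sortMachines.comp h.snd.snd.zipIdx

theorem pt_upperBound : PT upperBound :=
  have h := Comp.id (α := Problem)
  have h' := Comp.id (α := Problem × Job)
  (Comp.map pt_jobs h'.snd.fst).sum.mul h.snd.snd.sum

/-- The bound by the number of jobs is for the exact algorithm, the one in terms of the accuracy for
the PTAS. For the latter, a large load is `2 ^ k * c` with `c ≤ 2 * q`, and lies between `T / (q *
b)` and `T / b` for the machine's time `b`. This confines `k` to a window below `log₂ (T / b)` whose
length depends only on `q`. -/
theorem card_largeLoads_le (a : Problem) (T : ℕ) (M : ℕ × ℕ) :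
    (Stage.largeLoads ((a.1, T, a.jobs), M)).card ≤
      min a.2.1.length ((2 * a.1 ^ 2 + 1) * (2 * a.1 + 1)) := by
  refine le_min ?_ ?_
  · refine (Finset.card_filter_le _ _).trans ((List.toFinset_card_le _).trans ?_)
    simp [jobs, Stage.jobs]
  · rcases Nat.eq_zero_or_pos a.1 with hq | hq
    · have : Stage.largeLoads ((a.1, T, a.jobs), M) = ∅ := by
        refine Finset.filter_eq_empty_iff.2 fun r _ h => ?_
        have : T < a.1 * (M.1 * r) := h.1
        simp [hq] at this
      simp [this]
    · have hsub : Stage.largeLoads ((a.1, T, a.jobs), M) ⊆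
          (Finset.range (2 * a.1 ^ 2 + 1) ×ˢ Finset.range (2 * a.1 + 1)).image
            fun x => 2 ^ (Nat.log 2 (T / M.1) - x.1) * x.2 := by
        intro r hr
        obtain ⟨hmem, h1, h2⟩ := Finset.mem_filter.1 hr
        change T < a.1 * (M.1 * r) at h1
        change M.1 * r ≤ T at h2
        obtain ⟨x, hx, rfl⟩ := List.mem_map.1 (List.mem_toFinset.1 hmem)
        obtain ⟨y, -, rfl⟩ := List.mem_map.1 hx
        obtain ⟨k, c, hc, hr⟩ := exists_roundUp_eq hq y.1
        simp only [hr] at h1 h2 ⊢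
        have hpos : 0 < a.1 * (M.1 * (2 ^ k * c)) := Nat.zero_lt_of_lt h1
        have hM : 0 < M.1 := Nat.pos_of_ne_zero fun h => by simp [h] at hpos
        have hc0 : 0 < c := Nat.pos_of_ne_zero fun h => by simp [h] at hpos
        have hle : 2 ^ k * c ≤ T / M.1 := (Nat.le_div_iff_mul_le hM).2 (by rwa [mul_comm])
        have hne : T / M.1 ≠ 0 := fun h => by
          rw [h] at hle
          exact absurd hle (not_le.2 (by positivity))
        have hk : k ≤ Nat.log 2 (T / M.1) :=
          Nat.le_log_of_pow_le one_lt_two ((Nat.le_mul_of_pos_right _ hc0).trans hle)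
        obtain ⟨i, hi⟩ := Nat.exists_eq_add_of_le hk
        refine Finset.mem_image.2 ⟨(i, c), ?_, by simp [hi]⟩
        rw [Finset.mem_product, Finset.mem_range, Finset.mem_range]
        refine ⟨?_, Nat.lt_succ_of_le hc⟩
        have h3 : 2 ^ (k + i) ≤ T / M.1 := hi ▸ Nat.pow_log_le_self 2 hne
        have h4 : M.1 * 2 ^ k * 2 ^ i ≤ T := by
          rw [mul_assoc, ← pow_add, mul_comm]
          exact (Nat.le_div_iff_mul_le hM).1 h3
        have h5 : a.1 * (M.1 * (2 ^ k * c)) ≤ M.1 * 2 ^ k * (2 * a.1 ^ 2) := by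
          have := Nat.mul_le_mul_left (a.1 * M.1 * 2 ^ k) hc
          nlinarith
        -- Here `i` is the distance of the exponent `k` from the top of the window.
        have h6 : 2 ^ i < 2 * a.1 ^ 2 :=
          lt_of_mul_lt_mul_left (h4.trans_lt (h1.trans_le h5)) (Nat.zero_le _)
        have : i < 2 ^ i := Nat.lt_two_pow_self
        change i < 2 * a.1 ^ 2 + 1
        omega
      refine (Finset.card_le_card hsub).trans (Finset.card_image_le.trans ?_)
      simp

theorem searchWidth_le (a : Problem) (T : ℕ) (Ms : List (ℕ × ℕ)) :
    searchWidth ((a.1, T, a.jobs), Ms) ≤ a.width := by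
  have hl : a.jobs.length = a.2.1.length := by simp [jobs]
  unfold searchWidth width
  change (a.jobs.length + 1) ^ _ ≤ _
  rw [hl]
  exact Nat.pow_le_pow_right (Nat.succ_pos _) (Nat.mul_le_mul_left _
    (Finset.sup_le fun M _ => a.card_largeLoads_le T M))

theorem comp_solutions : Comp (fun x : Problem × ℕ => bits x + x.1.width) fun x => x.1.solutions x.2 := by
  have hb : PolyBdd (fun x : Problem × ℕ => bits x + x.1.width) bits :=
    PolyBdd.self.mono fun _ => Nat.le_add_right _ _
  have h := Comp.mono Comp.id hb
  have h' := Comp.id (α := Partial)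
  have he : Comp (fun x : Problem × ℕ => bits x + x.1.width)
      fun x => ((x.1.1, x.2, x.1.jobs), x.1.machines) :=
    (h.fst.fst.prod (h.snd.prod (pt_jobs.comp h.fst))).prod (pt_machines.comp h.fst)
  have hs : Comp (fun x : Problem × ℕ => bits x + x.1.width)
      fun x => search ((x.1.1, x.2, x.1.jobs), x.1.machines) :=
    comp_search.comp he ((he.bits_output.add (PolyBdd.self.mono fun x => Nat.le_add_left _ _)).mono
      fun x => Nat.add_le_add_left (x.1.searchWidth_le _ _) _)
  exact hs.filter (c := fun _ s => decide (s.1 = [])) (Comp.id.snd.fst.eq_nil)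

/-- Bounds the bit length of the makespans tried in the binary search. -/
theorem foldl_target_le (a : Problem) (l : List ℕ) (T : ℕ) :
    l.foldl (fun T p => if a.solutions (T + p - 1) = [] then T + p else T) T ≤ T + l.sum := by
  induction l generalizing T with
  | nil => simp
  | cons p l ih =>
    rw [List.foldl_cons, List.sum_cons]
    refine (ih _).trans ?_
    split <;> omega

theorem comp_target : Comp (fun a => bits a + a.width) target := by
  have hb : PolyBdd (fun a : Problem => bits a + a.width) bits :=
    PolyBdd.self.mono fun _ => Nat.le_add_right _ _
  have hw : PolyBdd (fun a : Problem => bits a + a.width) width :=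
    PolyBdd.self.mono fun _ => Nat.le_add_left _ _
  have hl := (PT.twoPowers.comp pt_upperBound).mono hb
  have hb' : PolyBdd (fun x : Problem × ℕ × ℕ => bits x + x.1.width) bits :=
    PolyBdd.self.mono fun _ => Nat.le_add_right _ _
  have h := Comp.mono Comp.id hb'
  have hT := (h.snd.fst.add h.snd.snd).sub (.const hb' 1)
  have hs := comp_solutions.comp (h.fst.prod hT) ((h.fst.prod hT).bits_output.add
    (PolyBdd.self.mono fun x => Nat.le_add_left _ _))
  refine Comp.foldl (l := fun a => twoPowers a.upperBound) (init := fun _ => 0)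
    (step := fun a T p => if a.solutions (T + p - 1) = [] then T + p else T)
    (ν := fun x : Problem × ℕ × ℕ => bits x + x.1.width)
    (.ite hs.eq_nil (h.snd.fst.add h.snd.snd) h.snd.fst) hl (.const hb 0)
    (B := fun a => bits a + (bits (twoPowers a.upperBound) + bits (twoPowers a.upperBound) + 1) + 1 +
      a.width) ?_ ?_
  · exact ((hb.add ((hl.bits_output.add hl.bits_output).add (.const 1))).add (.const 1)).add hw
  · intro a l₁ p l₂ hl
    have h1 := bits_mono (a.foldl_target_le l₁ 0)
    have h2 : bits p ≤ bits (twoPowers a.upperBound) := bits_le_of_mem (by simp [hl])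
    have h3 : bits l₁ ≤ bits (twoPowers a.upperBound) :=
      bits_le_of_sublist (hl ▸ List.sublist_append_left _ _)
    have h4 := bits_sum_le l₁
    rw [zero_add] at h1
    change bits a + (bits (List.foldl _ _ _) + bits p + 1) + 1 + a.width ≤ _
    omega

theorem comp_assignment : Comp (fun a => bits a + a.width) assignment := by
  have hb : PolyBdd (fun a : Problem => bits a + a.width) bits :=
    PolyBdd.self.mono fun _ => Nat.le_add_right _ _
  have h := (Comp.mono Comp.id hb).prod comp_target
  have h' := Comp.id (α := Problem × List (Job × ℕ) × Partial)
  refine Comp.foldl_of_bits_add (T := .X) (step := fun _ _ s => s.2.1) h'.snd.snd.snd.fst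
    (comp_solutions.comp h (h.bits_output.add (PolyBdd.self.mono fun _ => Nat.le_add_left _ _)))
    (.const hb []) fun a A s => ?_
  have h1 := bits_prod s
  have h2 := bits_prod s.2
  simp only [Polynomial.eval_X]
  omega

theorem comp_outcome : Comp (fun x : Problem × ℕ => bits x + x.1.width) fun x => x.1.outcome x.2 := by
  have hb : PolyBdd (fun x : Problem × ℕ => bits x + x.1.width) bits :=
    PolyBdd.self.mono fun _ => Nat.le_add_right _ _
  have h := Comp.mono Comp.id hb
  have hA : Comp (fun x : Problem × ℕ => bits x + x.1.width) fun x => x.1.assignment :=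
    comp_assignment.comp h.fst (PolyBdd.self.mono fun x => by
      have := bits_prod x
      omega)
  have hm : PT fun x : List (Job × ℕ) × ℕ => machineOf x.1 x.2 := by
    have h := Comp.id (α := List (Job × ℕ) × ℕ)
    have h' := Comp.id (α := (List (Job × ℕ) × ℕ) × ℕ × Job × ℕ)
    refine Comp.foldl_of_bits_add (T := .X)
      (step := fun (x : List (Job × ℕ) × ℕ) i y => if y.1.2.1 = x.2 then y.2 else i)
      (.ite (h'.snd.snd.fst.snd.fst.eq h'.fst.snd) h'.snd.snd.snd h'.snd.fst) h.fst
      (.const h.bits_input 0) fun x i y => ?_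
    have := bits_prod y
    simp only [Polynomial.eval_X]
    split <;> omega
  have hs : PT fun x : List (Job × ℕ) × ℕ => assignedSum (fun x => x.2.2) x.1 x.2 := by
    have h := Comp.id (α := List (Job × ℕ) × ℕ)
    have h' := Comp.id (α := (List (Job × ℕ) × ℕ) × Job × ℕ)
    exact ((h.fst.filter (h'.snd.snd.eq h'.fst.snd)).map h'.snd.fst.snd.snd).sum
  have h₁ := Comp.id (α := (List ℕ × List (Job × ℕ)) × ℕ × ℕ)
  have h₂ := Comp.id (α := (ℕ × List ℕ × List (Job × ℕ)) × ℕ × ℕ)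
  have hσ : PT fun x : List ℕ × List (Job × ℕ) => x.1.zipIdx.map fun y => machineOf x.2 y.2 :=
    Comp.map Comp.id.fst.zipIdx (hm.comp (h₁.fst.snd.prod h₁.snd.snd))
  have hp : PT fun x : ℕ × List ℕ × List (Job × ℕ) => x.2.1.zipIdx.map fun y =>
      (y.1 * assignedSum (fun x => x.2.2) x.2.2 y.2, x.1) :=
    Comp.map Comp.id.snd.fst.zipIdx (Comp.prod (h₂.snd.fst.mul (hs.comp (h₂.fst.snd.snd.prod h₂.snd.snd)))
      h₂.fst.fst)
  exact (hσ.comp (h.fst.snd.fst.prod hA)).prod (hp.comp (h.snd.prod (h.fst.snd.snd.prod hA)))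

end Problem

/-! ### Correctness of the algorithm for integral data. -/

theorem List.zipIdx_ofFn {α : Type*} {n : ℕ} (f : Fin n → α) :
    (List.ofFn f).zipIdx = List.ofFn fun i => (f i, (i : ℕ)) := by
  refine List.ext_getElem (by simp) fun i h₁ h₂ => by simp

theorem Multiset.coe_ofFn {α : Type*} {n : ℕ} (f : Fin n → α) :
    (↑(List.ofFn f) : Multiset α) = ∑ i, {f i} := by
  have h : ∀ l : List α, (↑l : Multiset α) = (l.map fun x => {x}).sum := by
    intro l
    induction l with
    | nil => rfl
    | cons x l ih => rw [List.map_cons, List.sum_cons, ← ih]; rfl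
  rw [h, List.map_ofFn, List.sum_ofFn]
  rfl

theorem assignedSum_eq_sum (f : Job → ℕ) (A : List (Job × ℕ)) (i : ℕ) :
    assignedSum f A i = (A.map fun y => if y.2 = i then f y.1 else 0).sum := by
  induction A with
  | nil => rfl
  | cons y A ih => rw [assignedSum_cons, ih, List.map_cons, List.sum_cons]

theorem machineOf_eq {A : List (Job × ℕ)} {j i : ℕ} (h : ∀ y ∈ A, y.1.2.1 = j → y.2 = i)
    (hex : ∃ y ∈ A, y.1.2.1 = j) : machineOf A j = i := by
  suffices hs : ∀ (A : List (Job × ℕ)) c, (∀ y ∈ A, y.1.2.1 = j → y.2 = i) →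
      (c = i ∨ ∃ y ∈ A, y.1.2.1 = j) → A.foldl (fun i y => if y.1.2.1 = j then y.2 else i) c = i from
    hs A 0 h (.inr hex)
  intro A
  induction A with
  | nil => simp
  | cons y A ih =>
    intro c h hc
    refine ih _ (fun z hz => h z (List.mem_cons_of_mem _ hz)) ?_
    beta_reduce
    by_cases hy : y.1.2.1 = j
    · rw [if_pos hy]
      exact .inl (h y List.mem_cons_self hy)
    · rw [if_neg hy]
      refine hc.imp_right ?_
      rintro ⟨z, hz, hzj⟩
      rcases List.mem_cons.1 hz with rfl | hz
      · exact absurd hzj hy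
      · exact ⟨z, hz, hzj⟩

theorem machineOf_of_mem {A : List (Job × ℕ)} (hA : (A.map fun y => y.1.2.1).Nodup) {y : Job × ℕ}
    (hy : y ∈ A) : machineOf A y.1.2.1 = y.2 :=
  machineOf_eq (fun z hz h => by rw [List.inj_on_of_nodup_map hA hz hy h]) ⟨y, hy, rfl⟩

/-- `S` stands for success of the search, which need not be monotone in the makespan; `F` stands for
the existence of a schedule, which is monotone and implies `S`. Before bit `k` is decided, the
search is known to succeed at the right end of the interval from `T` to `T + 2 ^ (k + 1) - 1`, and
`T` is a lower bound for `F`. A failure at the midpoint refutes `F` up to there, so no monotonicity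
of `S` is needed. -/
theorem foldl_twoPowers {S F : ℕ → Prop} [DecidablePred S] (hFS : ∀ T, F T → S T)
    (hF : ∀ T T', T ≤ T' → F T → F T') {x : ℕ} (hx : F x) :
    let T := (twoPowers x).foldl (fun T p => if S (T + p - 1) then T else T + p) 0
    S T ∧ ∀ T', F T' → T ≤ T' := by
  suffices h : ∀ k T, S (T + 2 ^ k - 1) → (∀ T', F T' → T ≤ T') →
      S ((((List.range k).map fun k => 2 ^ k).reverse).foldl
        (fun T p => if S (T + p - 1) then T else T + p) T) ∧
      ∀ T', F T' → (((List.range k).map fun k => 2 ^ k).reverse).foldl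
        (fun T p => if S (T + p - 1) then T else T + p) T ≤ T' by
    -- The initial interval ends at `2 ^ Nat.size x - 1`, which is at least `x`.
    refine h _ 0 (hFS _ (hF _ _ ?_ hx)) fun T' _ => Nat.zero_le _
    have := Nat.lt_size_self x
    omega
  intro k
  induction k with
  | zero => exact fun T h1 h2 => ⟨by simpa using h1, by simpa using h2⟩
  | succ k ih =>
    intro T h1 h2
    simp only [List.range_succ, List.map_append, List.map_cons, List.map_nil, List.reverse_append,
      List.reverse_cons, List.reverse_nil, List.nil_append, List.cons_append, List.foldl_cons]
    have hpos : 0 < 2 ^ k := by positivity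
    split
    · rename_i hS
      exact ih T hS h2
    · rename_i hS
      refine ih (T + 2 ^ k) ?_ fun T' hT' => ?_
      · rwa [add_assoc, ← two_mul, ← pow_succ']
      · by_contra! hlt
        exact hS (hFS _ (hF T' _ (by omega) hT'))

namespace Problem

section

variable {n m : ℕ} (q : ℕ) (w : Fin m → ℕ) (b : Fin n → ℕ)

theorem jobs_ofFn : jobs (q, List.ofFn w, List.ofFn b) =
    List.ofFn fun j => (roundUp q (w j), (j : ℕ), w j) := by
  rw [jobs, List.zipIdx_ofFn, List.map_ofFn]
  rfl

theorem nodup_jobs : ((jobs (q, List.ofFn w, List.ofFn b)).map fun x => x.2.1).Nodup := by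
  rw [jobs_ofFn, List.map_ofFn]
  exact List.nodup_ofFn.2 fun i j h => Fin.ext h

theorem machines_perm : (machines (q, List.ofFn w, List.ofFn b)).Perm
    (List.ofFn fun i => (b i, (i : ℕ))) := by
  rw [machines, List.zipIdx_ofFn]
  exact sortMachines_perm _

theorem sortedMachines : SortedMachines (machines (q, List.ofFn w, List.ofFn b)) := by
  refine List.Pairwise.and (pairwise_sortMachines _) ?_
  have h : ((List.ofFn fun i => (b i, (i : ℕ))).map Prod.snd).Nodup := by
    rw [List.map_ofFn]
    exact List.nodup_ofFn.2 fun i j h => Fin.ext h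
  exact List.pairwise_map.1 (((machines_perm q w b).map Prod.snd).nodup_iff.2 h)

variable {q w b}

theorem exists_solution (hq : 0 < q) (hw : ∀ j, 0 < w j) {T : ℕ} (τ : Fin m → Fin n)
    (hτ : ∀ i, b i * ∑ j with τ j = i, roundUp q (w j) ≤ T) :
    solutions (q, List.ofFn w, List.ofFn b) T ≠ [] := by
  obtain ⟨s, hs, h⟩ := exists_mem_search (e := (q, T, jobs (q, List.ofFn w, List.ofFn b)))
    (sortedMachines q w b) (nodup_jobs q w b) hq (fun x hx => by
      rw [jobs_ofFn] at hx
      obtain ⟨j, rfl⟩ := List.mem_ofFn.1 hx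
      exact (hw j).trans_le (le_roundUp _ _))
    (fun M => ∑ j with (τ j : ℕ) = M.2, {roundUp q (w j)}) (by
      rw [((machines_perm q w b).map _).sum_eq, List.map_ofFn, List.sum_ofFn, jobs_ofFn,
        List.map_ofFn, Multiset.coe_ofFn]
      simp only [Function.comp_apply, Fin.val_inj]
      exact Finset.sum_fiberwise _ _ _)
    (fun M hM => by
      obtain ⟨i, rfl⟩ := List.mem_ofFn.1 ((machines_perm q w b).subset hM)
      simpa [Multiset.sum_sum, Fin.val_inj] using hτ i)
  exact List.ne_nil_of_mem (List.mem_filter.2 ⟨hs, decide_eq_true h⟩)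

/-- The schedule and the loads that a solution stands for. -/
theorem exists_schedule (hq : 0 < q) {T : ℕ} {s : Partial}
    (hs : s ∈ solutions (q, List.ofFn w, List.ofFn b) T) : ∃ σ : Fin m → Fin n,
      (∀ j : Fin m, machineOf s.2.1 j = σ j) ∧
      (∀ i : Fin n, assignedSum (fun x => x.2.2) s.2.1 i = ∑ j with σ j = i, w j) ∧
      ∀ i, q * (b i * ∑ j with σ j = i, roundUp q (w j)) ≤ (q + 1) * T := by
  obtain ⟨hs, hU⟩ := List.mem_filter.1 hs
  have hU : s.1 = [] := of_decide_eq_true hU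
  obtain ⟨h1, h2, h3⟩ := isSound_search (sortedMachines q w b)
    (e := (q, T, jobs (q, List.ofFn w, List.ofFn b))) (nodup_jobs q w b) hq s hs
  rw [hU, List.append_nil] at h1
  have hnd : (s.2.1.map fun y => y.1.2.1).Nodup := by
    have := (h1.map fun x => x.2.1).nodup_iff.2 (nodup_jobs q w b)
    rwa [List.map_map] at this
  have hM := machines_perm q w b
  have hex : ∀ j : Fin m, ∃ i : Fin n, machineOf s.2.1 j = i := by
    intro j
    have : (roundUp q (w j), (j : ℕ), w j) ∈ s.2.1.map fun y => y.1 :=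
      h1.symm.subset (by rw [jobs_ofFn]; exact List.mem_ofFn.2 ⟨j, rfl⟩)
    obtain ⟨y, hy, hyj⟩ := List.mem_map.1 this
    obtain ⟨M, hM', hyM, -⟩ := h2 y hy
    obtain ⟨i, rfl⟩ := List.mem_ofFn.1 (hM.subset hM')
    have := machineOf_of_mem hnd hy
    rw [hyj] at this
    exact ⟨i, this.trans hyM⟩
  choose σ hσ using hex
  have hsum : ∀ (f : Job → ℕ) (i : Fin n), assignedSum f s.2.1 i =
      ∑ j with σ j = i, f (roundUp q (w j), (j : ℕ), w j) := by
    intro f i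
    have e1 : assignedSum f s.2.1 i =
        (s.2.1.map fun y => if machineOf s.2.1 y.1.2.1 = i then f y.1 else 0).sum := by
      rw [assignedSum_eq_sum]
      exact congrArg List.sum (List.map_congr_left fun y hy => by rw [machineOf_of_mem hnd hy])
    have e2 := (h1.map fun x : Job => if machineOf s.2.1 x.2.1 = i then f x else 0).sum_eq
    rw [List.map_map] at e2
    rw [e1, Finset.sum_filter]
    refine e2.trans ?_
    rw [jobs_ofFn, List.map_ofFn, List.sum_ofFn]
    simp [hσ, Fin.val_inj]
  refine ⟨σ, hσ, fun i => hsum _ i, fun i => ?_⟩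
  have := h3 (b i, (i : ℕ)) (hM.symm.subset (List.mem_ofFn.2 ⟨i, rfl⟩))
  rwa [hsum] at this


theorem target_spec (hn : 0 < n) (hq : 0 < q) (hw : ∀ j, 0 < w j) :
    let a : Problem := (q, List.ofFn w, List.ofFn b)
    a.solutions a.target ≠ [] ∧ ∀ (τ : Fin m → Fin n) T,
      (∀ i, b i * ∑ j with τ j = i, roundUp q (w j) ≤ T) → a.target ≤ T := by
  intro a
  have h := foldl_twoPowers (S := fun T => a.solutions T ≠ []) (x := a.upperBound)
    (F := fun T => ∃ τ : Fin m → Fin n, ∀ i, b i * ∑ j with τ j = i, roundUp q (w j) ≤ T)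
    (fun T ⟨τ, hτ⟩ => exists_solution hq hw τ hτ) (fun T T' hT ⟨τ, hτ⟩ => ⟨τ, fun i => (hτ i).trans hT⟩)
    -- All jobs on machine `0` already stay within the upper bound.
    ⟨fun _ => ⟨0, hn⟩, fun i => by
      have h1 : a.upperBound = (∑ j, roundUp q (w j)) * ∑ i, b i := by
        simp only [a, upperBound, jobs_ofFn, List.map_ofFn, List.sum_ofFn]
        rfl
      rw [h1, mul_comm]
      exact Nat.mul_le_mul (Finset.sum_le_sum_of_subset (Finset.filter_subset _ _))
        (Finset.single_le_sum (fun _ _ => Nat.zero_le _) (Finset.mem_univ i))⟩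
  simp only [ne_eq, ite_not] at h
  exact ⟨h.1, fun τ T hτ => h.2 T ⟨τ, hτ⟩⟩

/-- The outcome consists of a nearly optimal schedule and of payments that make up for the costs. -/
theorem exists_outcome_eq (hn : 0 < n) (hq : 0 < q) (hw : ∀ j, 0 < w j) (D : ℕ) :
    ∃ σ : Fin m → Fin n, outcome (q, List.ofFn w, List.ofFn b) D =
        (List.ofFn fun j => (σ j : ℕ), List.ofFn fun i => (b i * ∑ j with σ j = i, w j, D)) ∧
      ∀ (τ : Fin m → Fin n) i, ∃ i',
        q ^ 2 * (b i * ∑ j with σ j = i, w j) ≤ (q + 1) ^ 2 * (b i' * ∑ j with τ j = i', w j) := by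
  have hmem : ∀ l : List Partial, l ≠ [] → ∀ A, ∃ s ∈ l, l.foldl (fun _ s => s.2.1) A = s.2.1 := by
    intro l
    induction l with
    | nil => exact fun h => absurd rfl h
    | cons s l ih =>
      intro _ A
      rcases eq_or_ne l [] with rfl | hl
      · exact ⟨s, List.mem_cons_self, rfl⟩
      · obtain ⟨s', hs', h⟩ := ih hl s.2.1
        exact ⟨s', List.mem_cons_of_mem _ hs', h⟩
  obtain ⟨h1, h2⟩ := target_spec (b := b) hn hq hw
  obtain ⟨s, hs, hA⟩ := hmem _ h1 []
  obtain ⟨σ, hσ, hsum, hT⟩ := exists_schedule hq hs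
  refine ⟨σ, ?_, fun τ i => ?_⟩
  · refine Prod.ext ?_ ?_
    · simp only [outcome, List.zipIdx_ofFn, List.map_ofFn]
      refine congrArg List.ofFn (funext fun j => ?_)
      simp only [Function.comp_apply, assignment, hA, hσ]
    · simp only [outcome, List.zipIdx_ofFn, List.map_ofFn]
      refine congrArg List.ofFn (funext fun i => ?_)
      simp only [Function.comp_apply, assignment, hA, hsum]
  -- The bottleneck `i'` of `τ` for rounded loads: its time is a makespan feasible for `τ`, hence at
  -- least the target. One factor `(q + 1) / q` comes from filling, the other from rounding.
  · obtain ⟨i', -, hi'⟩ := Finset.exists_max_image (Finset.univ : Finset (Fin n))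
      (fun i => b i * ∑ j with τ j = i, roundUp q (w j)) ⟨⟨0, hn⟩, Finset.mem_univ _⟩
    refine ⟨i', ?_⟩
    have h3 := h2 τ _ fun i => hi' i (Finset.mem_univ i)
    have h4 : ∑ j with σ j = i, w j ≤ ∑ j with σ j = i, roundUp q (w j) :=
      Finset.sum_le_sum fun j _ => le_roundUp _ _
    have h5 : q * ∑ j with τ j = i', roundUp q (w j) ≤ (q + 1) * ∑ j with τ j = i', w j := by
      rw [Finset.mul_sum, Finset.mul_sum]
      exact Finset.sum_le_sum fun j _ => mul_roundUp_le _ _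
    calc q ^ 2 * (b i * ∑ j with σ j = i, w j)
        = q * (q * (b i * ∑ j with σ j = i, w j)) := by ring
      _ ≤ q * (q * (b i * ∑ j with σ j = i, roundUp q (w j))) := by gcongr
      _ ≤ q * ((q + 1) * (b i' * ∑ j with τ j = i', roundUp q (w j))) :=
        Nat.mul_le_mul_left _ ((hT i).trans (Nat.mul_le_mul_left _ h3))
      _ = (q + 1) * b i' * (q * ∑ j with τ j = i', roundUp q (w j)) := by ring
      _ ≤ (q + 1) * b i' * ((q + 1) * ∑ j with τ j = i', w j) := by gcongr
      _ = _ := by ring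

end

end Problem

/-! ## Mechanisms -/

/-- The mechanism with schedules `f` that pays to the machines what they declare as their costs. -/
noncomputable def SchedulingMechanism.payingCosts
    (f : ∀ {n m : ℕ} [NeZero n], (Fin m → PosRat) → (Fin n → PosRat) → (Fin m → Fin n)) :
    SchedulingMechanism where
  schedule := f
  payment w b i := (b i : ℚ) * machineLoad w (f w b) i

namespace SchedulingMechanism

variable (f : ∀ {n m : ℕ} [NeZero n], (Fin m → PosRat) → (Fin n → PosRat) → (Fin m → Fin n))

theorem monitoredCost_payingCosts {n m : ℕ} [NeZero n] (w : Fin m → PosRat) (D : Fin n → Set PosRat)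
    (i : Fin n) (t : D i) (b : ∀ k, D k) :
    ((payingCosts f).onDomain w D).monitoredCost (scheduleCost w D) i t b =
      max (scheduleCost w D i t (f w fun k => (b k : PosRat)))
        (scheduleCost w D i (b i) (f w fun k => (b k : PosRat))) -
        scheduleCost w D i (b i) (f w fun k => (b k : PosRat)) := rfl

/-- The truthful cost is 0 and every other monitored cost is nonnegative, for all schedules `f`;
even the actions of the other agents play no role. -/
theorem isOSPWithMonitoring_payingCosts : (payingCosts f).IsOSPWithMonitoring := by
  intro n m _ w D
  refine ⟨fun i _ b _ b' _ _ => ?_, fun _ => trivial⟩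
  rw [monitoredCost_payingCosts, monitoredCost_payingCosts, max_self, sub_self]
  exact sub_nonneg.2 (le_max_right _ _)

theorem voluntaryParticipation_payingCosts : (payingCosts f).VoluntaryParticipation := by
  intro n m _ w D i b
  rw [monitoredCost_payingCosts, max_self, sub_self]

end SchedulingMechanism

/-! ## Common denominators -/

/-- The product is as good as the least common multiple: its bit length is still polynomial in the
input. -/
def commonDen (l : List (ℕ × ℕ)) : ℕ := (l.map fun x => x.2).prod

def numerators (l : List (ℕ × ℕ)) : List ℕ := l.map fun x => x.1 * (commonDen l / x.2)

theorem pt_commonDen : PT commonDen :=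
  Comp.listProd (Comp.id.map Comp.id.snd.snd)

theorem pt_numerators : PT numerators :=
  have h := Comp.id (α := List (ℕ × ℕ) × ℕ × ℕ)
  Comp.id.map (h.snd.fst.mul ((pt_commonDen.comp h.fst).div h.snd.snd))

/-- The numerators and denominators of a family of rational numbers. -/
def fractions {n : ℕ} (w : Fin n → PosRat) : List (ℕ × ℕ) :=
  List.ofFn fun j => ((w j : ℚ).num.toNat, (w j : ℚ).den)

section

variable {n m : ℕ} (w : Fin m → PosRat) (b : Fin n → PosRat)

theorem commonDen_pos : 0 < commonDen (fractions w) := by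
  refine Nat.pos_of_ne_zero (List.prod_ne_zero fun h => ?_)
  rw [fractions, List.map_ofFn] at h
  obtain ⟨j, hj⟩ := List.mem_ofFn.1 h
  exact (w j : ℚ).den_nz hj

theorem exists_numerators_eq : ∃ v : Fin m → ℕ, numerators (fractions w) = List.ofFn v ∧
    (∀ j, 0 < v j) ∧ ∀ j, (v j : ℚ) = w j * commonDen (fractions w) := by
  have hv : ∀ j, (((w j : ℚ).num.toNat * (commonDen (fractions w) / (w j : ℚ).den) : ℕ) : ℚ) =
      w j * commonDen (fractions w) := by
    intro j
    have hdvd : (w j : ℚ).den ∣ commonDen (fractions w) := by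
      refine List.dvd_prod ?_
      rw [fractions, List.map_ofFn]
      exact List.mem_ofFn.2 ⟨j, rfl⟩
    have hd : ((w j : ℚ).den : ℚ) ≠ 0 := Nat.cast_ne_zero.2 (w j : ℚ).den_nz
    have hnum : (((w j : ℚ).num.toNat : ℕ) : ℚ) = (w j : ℚ).num := by
      have : (((w j : ℚ).num.toNat : ℕ) : ℤ) = (w j : ℚ).num :=
        Int.toNat_of_nonneg (Rat.num_pos.2 (w j).2).le
      exact_mod_cast this
    rw [Nat.cast_mul, Nat.cast_div hdvd hd, hnum, mul_div_assoc', mul_div_right_comm, Rat.num_div_den]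
  refine ⟨_, by rw [numerators]; nth_rw 2 [fractions]; rw [List.map_ofFn]; rfl, fun j => ?_, hv⟩
  have hpos : (0 : ℚ) < w j * commonDen (fractions w) :=
    mul_pos (w j).2 (Nat.cast_pos.2 (commonDen_pos w))
  rw [← hv j] at hpos
  exact Nat.cast_pos.1 hpos

theorem toVal_fractions : toVal (fractions w, fractions b) = Val.ofInstance w b := by
  simp only [toVal, Val.ofInstance, fractions, List.map_ofFn]
  rfl

/-- The integral scheduling problem, with the accuracy `1 / q`. -/
def problem (q : ℕ) (x : List (ℕ × ℕ) × List (ℕ × ℕ)) : Problem :=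
  (q, numerators x.1, numerators x.2)

/-- The outcome of the algorithm with the accuracy `1 / q`. -/
def solve (q : ℕ) (x : List (ℕ × ℕ) × List (ℕ × ℕ)) : List ℕ × List (ℕ × ℕ) :=
  (problem q x).outcome (commonDen x.1 * commonDen x.2)

/-- The accuracy for which all schedules that are found are optimal. -/
def exactAccuracy (x : List (ℕ × ℕ) × List (ℕ × ℕ)) : ℕ :=
  3 * ((numerators x.1).sum * (numerators x.2).sum) + 1

theorem makespan_le [NeZero n] {v : Fin m → ℕ} {c : Fin n → ℕ} {d d' : ℚ} (hd : 0 < d) (hd' : 0 < d')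
    (hv : ∀ j, (v j : ℚ) = w j * d) (hc : ∀ i, (c i : ℚ) = b i * d') {α : ℚ} (hα : 0 ≤ α)
    {σ τ : Fin m → Fin n} (h : ∀ i, ∃ i', ((c i * ∑ j with σ j = i, v j : ℕ) : ℚ) ≤
      α * (c i' * ∑ j with τ j = i', v j : ℕ)) : makespan w b σ ≤ α * makespan w b τ := by
  have key : ∀ (σ : Fin m → Fin n) i, ((c i * ∑ j with σ j = i, v j : ℕ) : ℚ) =
      d * d' * (b i * machineLoad w σ i) := by
    intro σ i
    rw [Nat.cast_mul, Nat.cast_sum, hc, machineLoad, ← Finset.sum_filter, Finset.sum_congr rfl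
      fun j _ => hv j, ← Finset.sum_mul]
    ring
  refine Finset.sup'_le _ _ fun i _ => ?_
  obtain ⟨i', hi⟩ := h i
  rw [key, key, mul_left_comm α] at hi
  refine (le_of_mul_le_mul_left hi (mul_pos hd hd')).trans (mul_le_mul_of_nonneg_left ?_ hα)
  exact Finset.le_sup' (fun i => (b i : ℚ) * machineLoad w τ i) (Finset.mem_univ i')

/-- The comparison `h` is required only for `y` up to the product of the sums, as every integral
machine time is bounded by it. This is what makes a finite accuracy sufficient for exactness. -/
theorem exists_isOutcome_solve [NeZero n] {q : ℕ} (hq : 0 < q) {α : ℚ} (hα : 0 ≤ α)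
    (h : ∀ x y : ℕ, y ≤ (numerators (fractions w)).sum * (numerators (fractions b)).sum →
      q ^ 2 * x ≤ (q + 1) ^ 2 * y → (x : ℚ) ≤ α * y) :
    ∃ σ : Fin m → Fin n, (toVal (solve q (fractions w, fractions b))).IsOutcome σ
        (fun i => (b i : ℚ) * machineLoad w σ i) ∧
      ∀ τ, makespan w b σ ≤ α * makespan w b τ := by
  obtain ⟨v, hv, hpos, hvw⟩ := exists_numerators_eq w
  obtain ⟨c, hc, -, hcb⟩ := exists_numerators_eq b
  have hd : (0 : ℚ) < commonDen (fractions w) := Nat.cast_pos.2 (commonDen_pos w)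
  have hd' : (0 : ℚ) < commonDen (fractions b) := Nat.cast_pos.2 (commonDen_pos b)
  obtain ⟨σ, hσ, hmax⟩ := Problem.exists_outcome_eq (b := c) (Nat.pos_of_neZero n) hq hpos
    (commonDen (fractions w) * commonDen (fractions b))
  refine ⟨σ, ⟨fun i => toVal (c i * ∑ j with σ j = i, v j,
    commonDen (fractions w) * commonDen (fractions b)), fun i => ⟨_, _, ?_, rfl, ?_⟩, ?_⟩, fun τ => ?_⟩
  · exact (Nat.mul_pos (commonDen_pos w) (commonDen_pos b)).ne'
  · change (b i : ℚ) * machineLoad w σ i = _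
    rw [Nat.cast_mul, Nat.cast_sum, hcb, machineLoad, ← Finset.sum_filter, Finset.sum_congr rfl
      fun j _ => hvw j, ← Finset.sum_mul, Nat.cast_mul]
    field_simp
  · simp only [solve, problem, hv, hc, hσ]
    simp only [toVal, List.map_ofFn]
    rfl
  · refine makespan_le w b hd hd' hvw hcb hα fun i => ?_
    obtain ⟨i', hi'⟩ := hmax τ i
    refine ⟨i', h _ _ ?_ hi'⟩
    rw [hv, hc, List.sum_ofFn, List.sum_ofFn, mul_comm]
    exact Nat.mul_le_mul (Finset.sum_le_sum_of_subset (Finset.filter_subset _ _))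
      (Finset.single_le_sum (fun _ _ => Nat.zero_le _) (Finset.mem_univ i'))

end

/-- Integral machine times leave no room for a small error: for `q > 3 * y` one has `(q + 1) ^ 2 * y
< q ^ 2 * (y + 1)`, so `x ≤ y`. -/
theorem exists_exact_solution {n m : ℕ} [NeZero n] (w : Fin m → PosRat) (b : Fin n → PosRat) :
    ∃ σ : Fin m → Fin n, (toVal (solve (exactAccuracy (fractions w, fractions b))
        (fractions w, fractions b))).IsOutcome σ (fun i => (b i : ℚ) * machineLoad w σ i) ∧
      ∀ τ, makespan w b σ ≤ makespan w b τ := by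
  obtain ⟨σ, h1, h2⟩ := exists_isOutcome_solve w b
    (q := exactAccuracy (fractions w, fractions b)) (Nat.succ_pos _) zero_le_one
    (fun x y hy h => by
      rw [one_mul, Nat.cast_le]
      by_contra! hlt
      have hq : 3 * y < exactAccuracy (fractions w, fractions b) := by
        change y ≤ (numerators (fractions w, fractions b).1).sum *
          (numerators (fractions w, fractions b).2).sum at hy
        unfold exactAccuracy; omega
      generalize exactAccuracy (fractions w, fractions b) = q at h hq
      have : q ^ 2 * (y + 1) ≤ q ^ 2 * x := Nat.mul_le_mul_left _ hlt
      nlinarith)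
  exact ⟨σ, h1, fun τ => by simpa using h2 τ⟩

theorem exists_approximate_solution (ε : PosRat) {n m : ℕ} [NeZero n] (w : Fin m → PosRat)
    (b : Fin n → PosRat) : ∃ σ : Fin m → Fin n, (toVal (solve (3 * (ε : ℚ).den + 1)
        (fractions w, fractions b))).IsOutcome σ (fun i => (b i : ℚ) * machineLoad w σ i) ∧
      ∀ τ, makespan w b σ ≤ (1 + (ε : ℚ)) * makespan w b τ := by
  have hε := ε.2
  refine exists_isOutcome_solve w b (Nat.succ_pos _) (by linarith) fun x y _ h => ?_
  have hden : (0 : ℚ) < (ε : ℚ).den := Nat.cast_pos.2 (ε : ℚ).den_pos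
  have h1 : 1 ≤ (ε : ℚ) * (ε : ℚ).den := by
    rw [Rat.mul_den_eq_num]
    exact_mod_cast Rat.num_pos.2 hε
  have h' : ((3 * (ε : ℚ).den + 1 : ℚ)) ^ 2 * x ≤ (3 * (ε : ℚ).den + 1 + 1) ^ 2 * y := by
    exact_mod_cast h
  generalize ((ε : ℚ).den : ℚ) = d at *
  have hy : (0 : ℚ) ≤ y := Nat.cast_nonneg y
  -- With `q = 3 * d + 1` this is `(1 + 1/q) ^ 2 ≤ 1 + 3/q ≤ 1 + 1/d ≤ 1 + ε`.
  have h2 : (3 * d + 1 + 1) ^ 2 ≤ (1 + (ε : ℚ)) * (3 * d + 1) ^ 2 := by nlinarith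
  refine le_of_mul_le_mul_left (h'.trans ((mul_le_mul_of_nonneg_right h2 hy).trans_eq ?_))
    (by positivity : (0 : ℚ) < (3 * d + 1) ^ 2)
  ring

/-! ## Running times -/

theorem comp_solve {α : Type} [ToVal α] {μ : α → ℕ} {q : α → ℕ} {x : α → List (ℕ × ℕ) × List (ℕ × ℕ)}
    (hq : Comp μ q) (hx : Comp μ x) (hw : PolyBdd μ fun a => (problem (q a) (x a)).width) :
    Comp μ fun a => solve (q a) (x a) := by
  have hp : Comp μ fun a => problem (q a) (x a) :=
    hq.prod ((pt_numerators.comp hx.fst).prod (pt_numerators.comp hx.snd))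
  have hD := (pt_commonDen.comp hx.fst).mul (pt_commonDen.comp hx.snd)
  have h := Comp.comp (g := fun y : Problem × ℕ => y.1.outcome y.2) Problem.comp_outcome (hp.prod hD)
    ((hp.prod hD).bits_output.add hw)
  exact h

theorem length_numerators_le (x : List (ℕ × ℕ) × List (ℕ × ℕ)) : (numerators x.1).length ≤ bits x := by
  have h1 := length_lt_bits x.1
  have h2 := bits_prod x
  rw [numerators, List.length_map]
  omega

/-- Turns a polynomial in an exponential quantity into a single power, whose exponent can be
absorbed into `2 ^ poly`. -/
theorem Polynomial.exists_eval_le_pow (T : Polynomial ℕ) : ∃ c, ∀ x, T.eval x ≤ (x + 2) ^ c := by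
  have h2 : ∀ c x : ℕ, c ≤ (x + 2) ^ c := fun c x =>
    Nat.lt_two_pow_self.le.trans (Nat.pow_le_pow_left (Nat.le_add_left _ _) c)
  induction T using Polynomial.induction_on' with
  | add S T hS hT =>
    obtain ⟨c, hc⟩ := hS
    obtain ⟨d, hd⟩ := hT
    refine ⟨c + d + 1, fun x => ?_⟩
    have h1 : 1 ≤ (x + 2) ^ c := Nat.one_le_pow _ _ (by omega)
    have h2 : 1 ≤ (x + 2) ^ d := Nat.one_le_pow _ _ (by omega)
    have := hc x
    have := hd x
    rw [Polynomial.eval_add, pow_succ, pow_add]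
    nlinarith [Nat.mul_le_mul h1 h2]
  | monomial n a =>
    refine ⟨a + n, fun x => ?_⟩
    rw [Polynomial.eval_monomial, pow_add]
    exact Nat.mul_le_mul (h2 a x) (Nat.pow_le_pow_left (by omega) n)

/-- The accuracy may be exponentially large, but the width is bounded by the number of jobs: it is
at most `(s + 1) ^ (2 * s) ≤ 2 ^ (2 * s * s)` for input size `s`. Only the bit length of the
accuracy enters otherwise. -/
theorem exists_exact_program : ∃ (P : Prog) (T : Polynomial ℕ), ∀ x : List (ℕ × ℕ) × List (ℕ × ℕ),
    ∃ k, P.Eval (toVal x) (toVal (solve (exactAccuracy x) x)) k ∧ k ≤ 2 ^ T.eval (bits x) := by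
  have hid := Comp.id (α := List (ℕ × ℕ) × List (ℕ × ℕ))
  let μ : List (ℕ × ℕ) × List (ℕ × ℕ) → ℕ := fun x => bits x + (bits x + 1) ^ (2 * bits x)
  have hb : PolyBdd μ bits := PolyBdd.self.mono fun _ => Nat.le_add_right _ _
  obtain ⟨P, T, hP⟩ := comp_solve (μ := μ) (q := exactAccuracy) (x := fun x => x)
    ((((Comp.const hid.bits_input 3).mul ((pt_numerators.comp hid.fst).sum.mul
      (pt_numerators.comp hid.snd).sum)).add (.const hid.bits_input 1)).mono hb)
    (hid.mono hb) (PolyBdd.self.mono fun x => by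
      have h := length_numerators_le x
      refine le_trans ?_ (Nat.le_add_left _ _)
      exact (Nat.pow_le_pow_right (Nat.succ_pos _) (Nat.mul_le_mul_left _
        ((min_le_left _ _).trans h))).trans (Nat.pow_le_pow_left (Nat.succ_le_succ h) _))
  obtain ⟨c, hc⟩ := T.exists_eval_le_pow
  refine ⟨P, (2 * .X * .X + .X + 2) * .C c, fun x => ?_⟩
  obtain ⟨k, hk, hkT⟩ := hP x
  refine ⟨k, hk, hkT.trans ((hc _).trans ?_)⟩
  simp only [Polynomial.eval_mul, Polynomial.eval_add, Polynomial.eval_X, Polynomial.eval_C,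
    Polynomial.eval_ofNat]
  rw [pow_mul]
  refine Nat.pow_le_pow_left ?_ c
  simp only [μ]
  generalize bits x = s
  have h1 : s + 1 ≤ 2 ^ s := Nat.lt_two_pow_self
  have h2 : (s + 1) ^ (2 * s) ≤ 2 ^ (2 * s * s) := by
    rw [show 2 * s * s = s * (2 * s) by ring, pow_mul 2]
    exact Nat.pow_le_pow_left h1 _
  have h3 : 1 ≤ 2 ^ (2 * s * s) := Nat.one_le_two_pow
  rw [pow_add, pow_add]
  nlinarith

/-- The accuracy is part of the input of one uniform program. For fixed `ε` its size and the
exponent of the width are constants, so the time is polynomial in the rest of the input. -/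
theorem exists_approximate_program : ∃ P : Prog, ∀ ε : PosRat, ∃ T : Polynomial ℕ,
    ∀ x : List (ℕ × ℕ) × List (ℕ × ℕ), ∃ k,
      P.Eval (.pair (Val.ofPosRat ε) (toVal x)) (toVal (solve (3 * (ε : ℚ).den + 1) x)) k ∧
      k ≤ T.eval (bits x) := by
  have hid := Comp.id (α := (ℕ × ℕ) × List (ℕ × ℕ) × List (ℕ × ℕ))
  let K : ℕ → ℕ := fun q => (2 * q ^ 2 + 1) * (2 * q + 1)
  let μ : (ℕ × ℕ) × List (ℕ × ℕ) × List (ℕ × ℕ) → ℕ := fun x =>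
    bits x + (bits x.2 + 1) ^ (2 * K (3 * x.1.2 + 1))
  have hb : PolyBdd μ bits := PolyBdd.self.mono fun _ => Nat.le_add_right _ _
  obtain ⟨P, T, hP⟩ := comp_solve (μ := μ) (q := fun x => 3 * x.1.2 + 1) (x := fun x => x.2)
    ((((Comp.const hid.bits_input 3).mul hid.fst.snd).add (.const hid.bits_input 1)).mono hb)
    (hid.snd.mono hb) (PolyBdd.self.mono fun x => by
      refine le_trans ?_ (Nat.le_add_left _ _)
      exact (Nat.pow_le_pow_right (Nat.succ_pos _) (Nat.mul_le_mul_left _ (min_le_right _ _))).trans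
        (Nat.pow_le_pow_left (Nat.succ_le_succ (length_numerators_le x.2)) _))
  refine ⟨P, fun ε => ⟨T.comp (.C ((Val.ofPosRat ε).size + 1) + .X +
    (.X + 1) ^ (2 * K (3 * (ε : ℚ).den + 1))), fun x => ?_⟩⟩
  obtain ⟨k, hk, hkT⟩ := hP (((ε : ℚ).num.toNat, (ε : ℚ).den), x)
  refine ⟨k, hk, hkT.trans_eq ?_⟩
  simp only [Polynomial.eval_comp, Polynomial.eval_add, Polynomial.eval_X, Polynomial.eval_C,
    Polynomial.eval_pow, Polynomial.eval_one, μ]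
  rw [bits_prod]
  change T.eval ((Val.ofPosRat ε).size + bits x + 1 + _) = _
  congr 1
  ring

theorem mainTheorem9 :
    (∃ A : SchedulingMechanism,
      A.IsOSPWithMonitoring ∧ A.VoluntaryParticipation ∧ A.IsOptimal ∧ A.RunsInExponentialTime) ∧
    (∃ A : PosRat → SchedulingMechanism,
      (∀ ε : PosRat, (A ε).IsOSPWithMonitoring ∧ (A ε).VoluntaryParticipation) ∧
      SchedulingMechanism.IsPTAS A) := by
  constructor
  -- The schedule is selected by choice, but the specification of the chosen schedule says that it
  -- is the one encoded in the output of the program.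
  · refine ⟨.payingCosts fun {n m} _ w b => (exists_exact_solution w b).choose,
      SchedulingMechanism.isOSPWithMonitoring_payingCosts _,
      SchedulingMechanism.voluntaryParticipation_payingCosts _,
      fun n m _ w b τ => (exists_exact_solution w b).choose_spec.2 τ, ?_⟩
    obtain ⟨P, T, hP⟩ := exists_exact_program
    refine ⟨P, T, fun n m _ w b => ?_⟩
    obtain ⟨k, hk, hkT⟩ := hP (fractions w, fractions b)
    rw [bits, toVal_fractions] at *
    exact ⟨_, k, hk, (exists_exact_solution w b).choose_spec.1, hkT⟩
  · refine ⟨fun ε => .payingCosts fun {n m} _ w b => (exists_approximate_solution ε w b).choose,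
      fun ε => ⟨SchedulingMechanism.isOSPWithMonitoring_payingCosts _,
        SchedulingMechanism.voluntaryParticipation_payingCosts _⟩,
      fun ε n m _ w b τ => (exists_approximate_solution ε w b).choose_spec.2 τ, ?_⟩
    obtain ⟨P, hP⟩ := exists_approximate_program
    refine ⟨P, fun ε => ?_⟩
    obtain ⟨T, hT⟩ := hP ε
    refine ⟨T, fun n m _ w b => ?_⟩
    obtain ⟨k, hk, hkT⟩ := hT (fractions w, fractions b)
    rw [bits, toVal_fractions] at *
    exact ⟨_, k, hk, (exists_approximate_solution ε w b).choose_spec.1, hkT⟩
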